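/- **Elias–Bassalygo bound for the linear program of the binary Johnson scheme.** For integers $0\le a\le \lfloor n/2\rfloor$ let $\mathcal S_a^n\subseteq\mathbb F_2^n$ be the set of words of Hamming weight $a$, with the distance $\tau_J=\tau_H/2$, where $\tau_H$ is the Hamming distance. For $0\le i\le a$ let $D_i$ be the adjacency matrix on $\mathcal S_a^n$ of the relation $\tau_J(x,y)=i$, let $E_0,\dots,E_a$ be the orthogonal projectors onto the common eigenspaces of $D_0,\dots,D_a$, and let the $q$-numbers $q_i(j)$ be given by $E_i=\frac1{|\mathcal S_a^n|}\sum_{j=0}^a q_i(j)D_j$. Let $A_{\rm LP}(n,d,a)$ be the maximum of $\sum_{t=0}^a u(t)$ over all $u:\{0,\dots,a\}\to\mathbb R$ with $u(0)=1$, $u(t)=0$ for $1\le t\le d-1$, $u(t)\ge 0$ for $d\le t\le a$, and $\sum_{t=0}^a u(t)q_i(t)\ge 0$ for $0\le i\le a$. Let $A(n,d,a)$ be the largest size of a subset of $\mathcal S_a^n$ any two distinct elements of which have Hamming distance at least $d$. Put $$R(\delta,\alpha)=\limsup_{n\to\infty}\tfrac1n\log_2A(n,\lfloor\delta n\rfloor,\lfloor\alpha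 n\rfloor),\qquad R_{\rm LP}(\delta,\alpha)=\limsup_{n\to\infty}\tfrac1n\log_2A_{\rm LP}(n,\lfloor\delta n\rfloor,\lfloor\alpha n\rfloor),$$ and $h(x)=-x\log_2x-(1-x)\log_2(1-x)$, with $0\log_2 0=0$. (1) Let $0\le a\le\lfloor n/2\rfloor$ and $0\le d\le a(n-a)/n$ be integers (for $n=0$ read the last bound as $0$). Then the maximum $A_{\rm LP}(n,d,a)$ exists and $A(n,2d,a)\le A_{\rm LP}(n,d,a)$. If moreover $d\ge1$, then $$A_{\rm LP}(n,d,a)\le (n-1)\,\frac{nd}{a(n-a)}\cdot\frac{\binom na}{\binom au\binom{n-a}u},\qquad u=\left\lfloor\frac{a(n-a)}n\left(1-\sqrt{1-\frac{nd}{a(n-a)}+\frac1{n-1}}\right)\right\rfloor .$$ (2) For all $\alpha\in(0,1/2)$ and $\delta\in[0,\alpha(1-\alpha)]$, $$R(2\delta,\alpha)\le R_{\rm LP}(\delta,\alpha)\le h(\alpha)-\left(\alpha\,h\!\left(\frac{K(\delta,\alpha)}{\alpha}\right)+(1-\alpha)\,h\!\left(\frac{K(\delta,\alpha)}{1-\alpha}\right)\right),$$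 where $K(\delta,\alpha)=\alpha(1-\alpha)\left(1-\sqrt{1-\frac{\delta}{\alpha(1-\alpha)}}\right)$. -/

import Mathlib

open Filter Matrix

noncomputable section

/-! ### The linear program of a distance-induced scheme `(X, τ, m)` -/

/-- The adjacency matrix `D_i` of the relation `τ x y = i`. -/
def adjMat {X : Type*} (τ : X → X → ℕ) (i : ℕ) : Matrix X X ℝ :=
  Matrix.of fun x y => if τ x y = i then 1 else 0

/-- `E` is the orthogonal projector onto one of the (nonzero, maximal) common eigenspaces
`{v | D_i v = lam i • v for all 0 ≤ i ≤ m}` of `D_0, …, D_m`. -/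
def IsEigenProjector {X : Type*} [Fintype X] (τ : X → X → ℕ) (m : ℕ)
    (E : Matrix X X ℝ) : Prop :=
  E.IsSymm ∧ E * E = E ∧ E ≠ 0 ∧
    ∃ lam : ℕ → ℝ, ∀ v : X → ℝ, E *ᵥ v = v ↔ ∀ i ≤ m, adjMat τ i *ᵥ v = lam i • v

/-- `q 0, …, q m` are the `q`-numbers belonging to one of the eigenprojectors `E`, that is,
`E = |X|⁻¹ ∑_j q(j) D_j`. -/
def IsQNumbers {X : Type*} [Fintype X] (τ : X → X → ℕ) (m : ℕ)
    (q : Fin (m + 1) → ℝ) : Prop :=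
  ∃ E : Matrix X X ℝ, IsEigenProjector τ m E ∧
    E = (1 / (Fintype.card X : ℝ)) • ∑ j : Fin (m + 1), q j • adjMat τ (j : ℕ)

/-- The constraints of Delsarte's linear program with minimum distance `d`. The last one runs
over all eigenprojectors; the order in which these are listed plays no role. -/
def IsDelsarteFeasible {X : Type*} [Fintype X] (τ : X → X → ℕ) (m d : ℕ)
    (u : Fin (m + 1) → ℝ) : Prop :=
  u 0 = 1 ∧
  (∀ t : Fin (m + 1), 1 ≤ (t : ℕ) → (t : ℕ) < d → u t = 0) ∧
  (∀ t : Fin (m + 1), d ≤ (t : ℕ) → 0 ≤ u t) ∧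
  (∀ q : Fin (m + 1) → ℝ, IsQNumbers τ m q → 0 ≤ ∑ t, u t * q t)

/-- The values that the objective function takes on the feasible points. -/
def delsarteValues {X : Type*} [Fintype X] (τ : X → X → ℕ) (m d : ℕ) : Set ℝ :=
  {s | ∃ u : Fin (m + 1) → ℝ, IsDelsarteFeasible τ m d u ∧ s = ∑ t, u t}

/-! ### The binary Johnson scheme -/

/-- The binary words of length `n` and Hamming weight `a`. -/
abbrev HammingSphere (n a : ℕ) : Type := {x : Fin n → ZMod 2 // hammingNorm x = a}

/-- The Johnson distance: half of the Hamming distance. Two words of the same weight are at an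
even Hamming distance, so that the division is exact. -/
def johnsonDist (n a : ℕ) (x y : HammingSphere n a) : ℕ := hammingDist x.1 y.1 / 2

/-- The values of Delsarte's linear program of the binary Johnson scheme. -/
def johnsonValues (n d a : ℕ) : Set ℝ := delsarteValues (johnsonDist n a) a d

/-- `A_LP(n,d,a)`: the maximum of Delsarte's linear program of the binary Johnson scheme. -/
def johnsonALP (n d a : ℕ) : ℝ := sSup (johnsonValues n d a)

open Classical in
/-- `A(n,d,a)`: the largest size of a set of binary words of length `n` and weight `a` any two
distinct elements of which have Hamming distance at least `d`. -/
def constWeightA (n d a : ℕ) : ℕ :=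
  ((Finset.univ : Finset (Finset (HammingSphere n a))).filter
    (fun C => ∀ x ∈ C, ∀ y ∈ C, x ≠ y → d ≤ hammingDist x.1 y.1)).sup Finset.card

/-- `R(δ,α)`, the upper limit of `(1/n) log₂ A(n, ⌊δn⌋, ⌊αn⌋)`. -/
def constWeightRate (δ α : ℝ) : EReal :=
  limsup (fun n : ℕ =>
    ((1 / (n : ℝ) * Real.logb 2 (constWeightA n ⌊δ * n⌋₊ ⌊α * n⌋₊ : ℝ) : ℝ) : EReal)) atTop

/-- `R_LP(δ,α)`, the upper limit of `(1/n) log₂ A_LP(n, ⌊δn⌋, ⌊αn⌋)`. -/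
def johnsonRateLP (δ α : ℝ) : EReal :=
  limsup (fun n : ℕ =>
    ((1 / (n : ℝ) * Real.logb 2 (johnsonALP n ⌊δ * n⌋₊ ⌊α * n⌋₊) : ℝ) : EReal)) atTop

/-! ### The bounds -/

/-- The binary entropy, in bits. -/
def entropyTwo (x : ℝ) : ℝ := -(1 - x) * Real.logb 2 (1 - x) - x * Real.logb 2 x

/-- The radius `u` of the finite bound. -/
def ebRadius (n d a : ℕ) : ℕ :=
  ⌊((a : ℝ) * (n - a) / n) *
    (1 - Real.sqrt (1 - (n : ℝ) * d / (a * (n - a)) + 1 / ((n : ℝ) - 1)))⌋₊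

/-- `K(δ,α) = α(1-α)(1 - √(1 - δ/(α(1-α))))`. -/
def ebK (δ α : ℝ) : ℝ := α * (1 - α) * (1 - Real.sqrt (1 - δ / (α * (1 - α))))

end

/-!
A point `u` of Delsarte's linear program stands for the matrix `M = ∑ u(t)/v_t D_t`
(`programMatrix`), where `v_t` is the valency of `D_t`. The trace of `M E` for an eigenprojector
`E` with `q`-numbers `q` is `∑ u(t) q(t)`, so the constraints of the program say that `M` is
positive semidefinite (`posSemidef_programMatrix`). This needs every eigenprojector to be a
combination of the `D_j`, which follows from the symmetry of the Johnson scheme: coordinate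
permutations act transitively on the pairs of words at a given distance, and a matrix invariant
under them is a combination of the `D_j`.

If `u` is feasible, `M` has diagonal `1`, nonnegative entries, and zeros at the distances
`1, …, d - 1`; the all-ones vector is an eigenvector with eigenvalue `∑ u(t)`. Hence for every set
`S` of words `(∑ u(t)) |S|² ≤ |X| ∑_{y,z ∈ S} M(y,z)` (`sum_mul_card_sq_le`). Take for `S` a sphere
of radius `r` in the Johnson metric. Translated by the mean of `S`, its words have inner products
`Δ - τ(y,z)` with `Δ = 2r - r²n/(a(n-a))` (`sum_centered_mul_centered`), so that
`∑_{y,z ∈ S} (Δ - τ(y,z)) M(y,z) ≥ 0`. When `Δ < d` this bounds the sum of `M` over `S × S` by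
`|S| d/(d - Δ)`, as in Plotkin's bound for codes
(`IsDelsarteFeasible.sum_programMatrix_le`). Together,
`∑ u(t) ≤ d/(d - Δ) · |X|/|S|` (`johnsonALP_le_of_radius`), and the radius of the finite bound is
chosen so that `d - Δ ≥ a(n-a)/(n(n-1))`.

For the rates, the bound is applied on spheres of relative radius `κ < K(δ,α)`. The factor
`d/(d - Δ)` then converges, the binomial coefficients are estimated by Stirling's formula
(`tendsto_log_choose_div`), and `κ` tends to `K(δ,α)` at the end. Since the bound with radius `r`
does not require `d ≤ a(n-a)/n`, the case `δ = α(1-α)` is not special. For `δ = 0` there is no such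
`κ`, and the trivial bound `|X|` is used.
-/

noncomputable section

/-! ### Two-point homogeneous schemes -/

section Scheme

variable {X : Type*}

/-- The permutation `g` preserves the distance function `τ`. -/
def PreservesDist (τ : X → X → ℕ) (g : Equiv.Perm X) : Prop :=
  ∀ x y, τ (g x) (g y) = τ x y

/-- `(X, τ)` is a two-point homogeneous space of diameter `m` in which every distance
`0, …, m` occurs: two pairs at the same distance are related by a distance-preserving
permutation. -/
structure IsTwoPointHomogeneous (τ : X → X → ℕ) (m : ℕ) : Prop where
  eq_zero_iff : ∀ x y, τ x y = 0 ↔ x = y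
  symm : ∀ x y, τ x y = τ y x
  le : ∀ x y, τ x y ≤ m
  exists_pair : ∀ t ≤ m, ∃ x y, τ x y = t
  exists_perm : ∀ x y x' y', τ x y = τ x' y' →
    ∃ g : Equiv.Perm X, PreservesDist τ g ∧ g x = x' ∧ g y = y'

/-- `A` commutes with all distance-preserving permutations. In a two-point homogeneous space the
invariant matrices are the linear combinations of the adjacency matrices. -/
def IsInvariantMatrix (τ : X → X → ℕ) (A : Matrix X X ℝ) : Prop :=
  ∀ g, PreservesDist τ g → ∀ x y, A (g x) (g y) = A x y

lemma isInvariantMatrix_adjMat (τ : X → X → ℕ) (i : ℕ) : IsInvariantMatrix τ (adjMat τ i) :=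
  fun g hg x y => by simp [adjMat, hg x y]

lemma IsInvariantMatrix.mul [Fintype X] {τ : X → X → ℕ} {A B : Matrix X X ℝ}
    (hA : IsInvariantMatrix τ A) (hB : IsInvariantMatrix τ B) : IsInvariantMatrix τ (A * B) := by
  intro g hg x y
  rw [Matrix.mul_apply, Matrix.mul_apply, ← Equiv.sum_comp g]
  simp [hA g hg, hB g hg]

variable {τ : X → X → ℕ} {m : ℕ}

lemma IsInvariantMatrix.apply_eq {A : Matrix X X ℝ} (hA : IsInvariantMatrix τ A)
    (h : IsTwoPointHomogeneous τ m) {x y x' y' : X} (hτ : τ x y = τ x' y') :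
    A x y = A x' y' := by
  obtain ⟨g, hg, rfl, rfl⟩ := h.exists_perm x y x' y' hτ
  exact (hA g hg x y).symm

lemma IsInvariantMatrix.isSymm {A : Matrix X X ℝ} (hA : IsInvariantMatrix τ A)
    (h : IsTwoPointHomogeneous τ m) : A.IsSymm :=
  Matrix.IsSymm.ext fun x y => hA.apply_eq h (h.symm y x)

lemma adjMat_isSymm (h : IsTwoPointHomogeneous τ m) (i : ℕ) : (adjMat τ i).IsSymm :=
  (isInvariantMatrix_adjMat τ i).isSymm h

/-- The products of adjacency matrices are symmetric, because they are invariant; hence the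
adjacency matrices commute. -/
lemma adjMat_commute [Fintype X] (h : IsTwoPointHomogeneous τ m) (i j : ℕ) :
    Commute (adjMat τ i) (adjMat τ j) := by
  have hs := ((isInvariantMatrix_adjMat τ i).mul (isInvariantMatrix_adjMat τ j)).isSymm h
  rw [Matrix.IsSymm, Matrix.transpose_mul, adjMat_isSymm h, adjMat_isSymm h] at hs
  exact hs.symm

/-! ### Eigenprojectors -/

/-- An orthogonal projector is determined by the vectors that it fixes. -/
lemma projector_eq_of_mulVec_eq_iff [Fintype X] {E F : Matrix X X ℝ} (hE : E.IsSymm)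
    (hEE : E * E = E) (hF : F.IsSymm) (hFF : F * F = F)
    (hfix : ∀ v, E *ᵥ v = v ↔ F *ᵥ v = v) : E = F := by
  -- the columns of one projector are fixed by the other
  have key : ∀ {A B : Matrix X X ℝ}, B * B = B → (∀ v, A *ᵥ v = v ↔ B *ᵥ v = v) →
      A * B = B := by
    intro A B hB hAB
    ext x y
    have h1 : A *ᵥ (B.col y) = B.col y := by
      rw [hAB]
      ext z
      exact congrFun (congrFun hB z) y
    exact congrFun h1 x
  have h1 : E * F = F := key hFF hfix
  have h2 : F * E = E := key hEE fun v => (hfix v).symm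
  have h3 := congrArg Matrix.transpose h1
  rw [Matrix.transpose_mul, hE, hF, h2] at h3
  exact h3

/-- A distance-preserving permutation maps every common eigenspace of the adjacency matrices onto
itself, so that the projectors are invariant. -/
lemma IsEigenProjector.isInvariantMatrix [Fintype X] {E : Matrix X X ℝ}
    (hE : IsEigenProjector τ m E) : IsInvariantMatrix τ E := by
  obtain ⟨hs, hi, -, lam, hl⟩ := hE
  intro g hg
  have hD : ∀ i, (adjMat τ i).submatrix g g = adjMat τ i := by
    intro i
    ext x y
    exact isInvariantMatrix_adjMat τ i g hg x y
  have hfix : ∀ v, (E.submatrix g g) *ᵥ v = v ↔ E *ᵥ v = v := by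
    intro v
    rw [Matrix.submatrix_mulVec_equiv, hl v, ← Equiv.eq_comp_symm, hl]
    refine forall₂_congr fun i _ => ?_
    have h1 := Matrix.submatrix_mulVec_equiv (adjMat τ i) v g g
    rw [hD] at h1
    rw [h1, ← Equiv.eq_comp_symm]
    rfl
  have := projector_eq_of_mulVec_eq_iff (hs.submatrix g)
    (by rw [Matrix.submatrix_mul_equiv, hi]) hs hi hfix
  intro x y
  exact congrFun (congrFun this x) y

/-- The common eigenspaces of the adjacency matrices have eigenprojectors. -/
lemma exists_isEigenProjector [Fintype X] [DecidableEq X] (lam : ℕ → ℝ) {w : X → ℝ}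
    (hw : w ≠ 0) (hlam : ∀ i ≤ m, adjMat τ i *ᵥ w = lam i • w) :
    ∃ E : Matrix X X ℝ, IsEigenProjector τ m E ∧
      ∀ v : X → ℝ, E *ᵥ v = v ↔ ∀ i ≤ m, adjMat τ i *ᵥ v = lam i • v := by
  let V : Submodule ℝ (EuclideanSpace ℝ X) :=
    { carrier := {v | ∀ i ≤ m, adjMat τ i *ᵥ v.ofLp = lam i • v.ofLp}
      add_mem' := by
        intro a b ha hb i hi
        simp [Matrix.mulVec_add, ha i hi, hb i hi]
      zero_mem' := by intro i _; simp
      smul_mem' := by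
        intro c a ha i hi
        simp [Matrix.mulVec_smul, ha i hi, smul_comm c] }
  let Φ := Matrix.toEuclideanCLM (n := X) (𝕜 := ℝ)
  let E := Φ.symm V.starProjection
  have hΦ : Φ E = V.starProjection := Φ.apply_symm_apply _
  have hfix : ∀ v : X → ℝ, E *ᵥ v = v ↔ ∀ i ≤ m, adjMat τ i *ᵥ v = lam i • v := by
    intro v
    have h1 : V.starProjection (WithLp.toLp 2 v) = WithLp.toLp 2 (E *ᵥ v) := by
      rw [← hΦ]; rfl
    have h2 := V.starProjection_eq_self_iff (v := WithLp.toLp 2 v)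
    rw [h1] at h2
    exact ⟨fun h => h2.1 (by rw [h]), fun h => congrArg WithLp.ofLp (h2.2 h)⟩
  refine ⟨E, ⟨?_, ?_, ?_, lam, hfix⟩, hfix⟩
  · have h1 : star E = E := by
      have h2 : Φ (star E) = Φ E := by
        rw [map_star, hΦ]
        exact isSelfAdjoint_starProjection V
      exact EquivLike.injective Φ h2
    rw [Matrix.star_eq_conjTranspose, Matrix.conjTranspose_eq_transpose_of_trivial] at h1
    exact h1
  · have h2 : Φ (E * E) = Φ E := by
      rw [map_mul, hΦ]
      exact V.isIdempotentElem_starProjection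
    exact EquivLike.injective Φ h2
  · intro h0
    have := (hfix w).2 hlam
    rw [h0, Matrix.zero_mulVec] at this
    exact hw this.symm

lemma sum_smul_adjMat_apply (h : IsTwoPointHomogeneous τ m) (c : Fin (m + 1) → ℝ) (x y : X) :
    (∑ t, c t • adjMat τ t) x y = c ⟨τ x y, Nat.lt_succ_of_le (h.le x y)⟩ := by
  rw [Matrix.sum_apply, Finset.sum_eq_single ⟨τ x y, Nat.lt_succ_of_le (h.le x y)⟩]
  · simp [adjMat]
  · intro t _ ht
    have : τ x y ≠ t := fun h' => ht (Fin.ext h'.symm)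
    simp [adjMat, this]
  · simp

lemma isInvariantMatrix_sum (c : Fin (m + 1) → ℝ) :
    IsInvariantMatrix τ (∑ t, c t • adjMat τ t) := by
  intro g hg x y
  simp [Matrix.sum_apply, isInvariantMatrix_adjMat τ _ g hg x y]

/-! ### Feasible points and positive semidefinite matrices -/

variable [Fintype X]

/-- The number of ordered pairs of points at distance `t`. -/
def pairCount (τ : X → X → ℕ) (t : ℕ) : ℕ :=
  (Finset.univ.filter fun p : X × X => τ p.1 p.2 = t).card

/-- The matrix `∑ u(t)/v_t D_t`, with `v_t` the valency of `D_t`, that the point `u` of Delsarte's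
linear program stands for. As `|X| v_t` is the number of pairs at distance `t`, the row sums of
the matrix are `∑ u(t)`. -/
def programMatrix (τ : X → X → ℕ) (m : ℕ) (u : Fin (m + 1) → ℝ) : Matrix X X ℝ :=
  ∑ t : Fin (m + 1), ((Fintype.card X : ℝ) * u t / pairCount τ t) • adjMat τ t

lemma pairCount_pos (h : IsTwoPointHomogeneous τ m) {t : ℕ} (ht : t ≤ m) :
    0 < pairCount τ t := by
  obtain ⟨x, y, hxy⟩ := h.exists_pair t ht
  exact Finset.card_pos.2 ⟨(x, y), by simpa using hxy⟩

lemma sum_adjMat (τ : X → X → ℕ) (t : ℕ) : ∑ x, ∑ y, adjMat τ t x y = pairCount τ t := by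
  rw [← Fintype.sum_prod_type' (f := fun x y => adjMat τ t x y)]
  simp [adjMat, pairCount]

lemma pairCount_zero (h : IsTwoPointHomogeneous τ m) : pairCount τ 0 = Fintype.card X := by
  classical
  have : (pairCount τ 0 : ℝ) = Fintype.card X := by
    rw [← sum_adjMat]
    simp [adjMat, h.eq_zero_iff]
  exact_mod_cast this

/-- The trace inner product of `programMatrix τ m u` with an element of the Bose–Mesner algebra. -/
lemma sum_programMatrix_mul (h : IsTwoPointHomogeneous τ m) (u q : Fin (m + 1) → ℝ) :
    ∑ x, ∑ y, programMatrix τ m u x y * (∑ t, q t • adjMat τ t) x y =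
      Fintype.card X * ∑ t, u t * q t := by
  have h1 : ∀ x y, programMatrix τ m u x y * (∑ t, q t • adjMat τ t) x y =
      ∑ t : Fin (m + 1),
        ((Fintype.card X : ℝ) * u t / pairCount τ t * q t) * adjMat τ t x y := by
    intro x y
    have := sum_smul_adjMat_apply h
      (fun t => (Fintype.card X : ℝ) * u t / pairCount τ t * q t) x y
    rw [programMatrix, sum_smul_adjMat_apply h, sum_smul_adjMat_apply h, ← this]
    simp [Matrix.sum_apply]
  simp_rw [h1]
  rw [Finset.mul_sum]
  calc _ = ∑ x, ∑ t : Fin (m + 1), ∑ y,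
        ((Fintype.card X : ℝ) * u t / pairCount τ t * q t) * adjMat τ t x y :=
        Finset.sum_congr rfl fun x _ => Finset.sum_comm
    _ = ∑ t : Fin (m + 1), ∑ x, ∑ y,
        ((Fintype.card X : ℝ) * u t / pairCount τ t * q t) * adjMat τ t x y := Finset.sum_comm
    _ = _ := by
        refine Finset.sum_congr rfl fun t _ => ?_
        simp_rw [← Finset.mul_sum]
        rw [sum_adjMat]
        have := (pairCount_pos h (Nat.le_of_lt_succ t.2)).ne'
        field_simp

/-- Being invariant, an eigenprojector is a combination of the adjacency matrices, so that it does
have `q`-numbers. -/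
lemma IsEigenProjector.exists_isQNumbers [Nonempty X] (h : IsTwoPointHomogeneous τ m)
    {E : Matrix X X ℝ} (hE : IsEigenProjector τ m E) :
    ∃ q : Fin (m + 1) → ℝ, IsQNumbers τ m q ∧
      E = (1 / (Fintype.card X : ℝ)) • ∑ j : Fin (m + 1), q j • adjMat τ (j : ℕ) := by
  choose p p' hp using fun t : Fin (m + 1) => h.exists_pair t (Nat.le_of_lt_succ t.2)
  have hEq : E = (1 / (Fintype.card X : ℝ)) • ∑ j : Fin (m + 1),
      ((Fintype.card X : ℝ) * E (p j) (p' j)) • adjMat τ (j : ℕ) := by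
    ext x y
    rw [Matrix.smul_apply, sum_smul_adjMat_apply h]
    have h0 : (Fintype.card X : ℝ) ≠ 0 := by simp
    rw [smul_eq_mul, ← mul_assoc, one_div, inv_mul_cancel₀ h0, one_mul]
    exact hE.isInvariantMatrix.apply_eq h (by rw [hp])
  exact ⟨_, ⟨E, hE, hEq⟩, hEq⟩

lemma trace_pos_of_projector {E : Matrix X X ℝ} (hs : E.IsSymm) (hi : E * E = E)
    (h0 : E ≠ 0) : 0 < E.trace := by
  have h1 : E.trace = ∑ x, ∑ y, E x y ^ 2 := by
    conv_lhs => rw [← hi]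
    simp only [Matrix.trace, Matrix.diag, Matrix.mul_apply]
    refine Finset.sum_congr rfl fun x _ => Finset.sum_congr rfl fun y _ => ?_
    rw [hs.apply x y, sq]
  rw [h1]
  obtain ⟨x, y, hxy⟩ : ∃ x y, E x y ≠ 0 := by
    by_contra! hc
    exact h0 (by ext x y; exact hc x y)
  refine Finset.sum_pos' (fun x _ => Finset.sum_nonneg fun y _ => sq_nonneg _)
    ⟨x, Finset.mem_univ _, Finset.sum_pos' (fun y _ => sq_nonneg _)
      ⟨y, Finset.mem_univ _, by positivity⟩⟩

/-- No nonzero vector is orthogonal to all common eigenvectors of the adjacency matrices: as these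
matrices are symmetric and commute, their common eigenspaces span the whole space. -/
lemma exists_common_eigenvector [DecidableEq X] (h : IsTwoPointHomogeneous τ m) {v : X → ℝ}
    (hv : v ≠ 0) : ∃ (lam : ℕ → ℝ) (w : X → ℝ),
      v ⬝ᵥ w ≠ 0 ∧ ∀ i ≤ m, adjMat τ i *ᵥ w = lam i • w := by
  let T : ℕ → EuclideanSpace ℝ X →ₗ[ℝ] EuclideanSpace ℝ X :=
    fun i => Matrix.toEuclideanLin (adjMat τ i)
  have hT : ∀ i, (T i).IsSymmetric := fun i => by
    rw [Matrix.isSymmetric_toEuclideanLin_iff, Matrix.IsHermitian,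
      Matrix.conjTranspose_eq_transpose_of_trivial]
    exact adjMat_isSymm h i
  have hC : Pairwise (Function.onFun Commute T) := by
    intro i j _
    have hc := adjMat_commute h i j
    ext1 x
    change WithLp.toLp 2 (adjMat τ i *ᵥ (adjMat τ j *ᵥ x.ofLp)) =
      WithLp.toLp 2 (adjMat τ j *ᵥ (adjMat τ i *ᵥ x.ofLp))
    rw [Matrix.mulVec_mulVec, Matrix.mulVec_mulVec, hc.eq]
  have htop := LinearMap.IsSymmetric.iSup_iInf_eq_top_of_commute hT hC
  by_contra! hcon
  apply hv
  have hall : ∀ x : EuclideanSpace ℝ X, v ⬝ᵥ x.ofLp = 0 := by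
    intro x
    have hx : x ∈ ⨆ χ : ℕ → ℝ, ⨅ i, Module.End.eigenspace (T i) (χ i) := by
      rw [htop]; trivial
    induction hx using Submodule.iSup_induction' with
    | mem χ y hy =>
      by_contra hne
      obtain ⟨i, -, hi⟩ := hcon χ y.ofLp hne
      apply hi
      have h1 := Module.End.mem_eigenspace_iff.1 ((Submodule.mem_iInf _).1 hy i)
      exact congrArg WithLp.ofLp h1
    | zero => simp
    | add y z _ _ hy hz => simp [hy, hz]
  exact dotProduct_self_eq_zero.1 (hall (WithLp.toLp 2 v))

/-- The constraints of the linear program say that the matrix of a feasible point is positive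
semidefinite. -/
lemma posSemidef_programMatrix [Nonempty X] (h : IsTwoPointHomogeneous τ m)
    {u : Fin (m + 1) → ℝ} (hu : ∀ q : Fin (m + 1) → ℝ, IsQNumbers τ m q → 0 ≤ ∑ t, u t * q t) :
    (programMatrix τ m u).PosSemidef := by
  classical
  have hsymm : (programMatrix τ m u).IsSymm := (isInvariantMatrix_sum _).isSymm h
  have hherm : (programMatrix τ m u).IsHermitian := by
    rw [Matrix.IsHermitian, Matrix.conjTranspose_eq_transpose_of_trivial]
    exact hsymm
  rw [hherm.posSemidef_iff_eigenvalues_nonneg]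
  intro k
  set μ := hherm.eigenvalues k
  set v : X → ℝ := (hherm.eigenvectorBasis k).ofLp with hvdef
  have hMv : programMatrix τ m u *ᵥ v = μ • v := hherm.mulVec_eigenvectorBasis k
  have hv : v ≠ 0 := fun h0 => by
    have h1 : hherm.eigenvectorBasis k = 0 := by ext x; exact congrFun h0 x
    have h2 := hherm.eigenvectorBasis.orthonormal.1 k
    rw [h1, norm_zero] at h2
    exact zero_ne_one h2
  obtain ⟨lam, w, hvw, hw⟩ := exists_common_eigenvector h hv
  -- the matrix acts on the common eigenspace of `w` as a scalar, which must be `μ`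
  have hact : ∀ z : X → ℝ, (∀ i ≤ m, adjMat τ i *ᵥ z = lam i • z) →
      programMatrix τ m u *ᵥ z = μ • z := by
    set c := ∑ t : Fin (m + 1), ((Fintype.card X : ℝ) * u t / pairCount τ t) * lam t
    have hc : ∀ z : X → ℝ, (∀ i ≤ m, adjMat τ i *ᵥ z = lam i • z) →
        programMatrix τ m u *ᵥ z = c • z := by
      intro z hz
      rw [programMatrix, Matrix.sum_mulVec, Finset.sum_smul]
      refine Finset.sum_congr rfl fun t _ => ?_
      rw [Matrix.smul_mulVec, hz t (Nat.le_of_lt_succ t.2), smul_smul]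
    have h1 : μ * (v ⬝ᵥ w) = c * (v ⬝ᵥ w) := by
      have h2 : (programMatrix τ m u *ᵥ v) ⬝ᵥ w = v ⬝ᵥ (programMatrix τ m u *ᵥ w) := by
        rw [Matrix.dotProduct_mulVec, ← Matrix.mulVec_transpose, hsymm]
      rwa [hMv, hc w hw, smul_dotProduct, dotProduct_smul] at h2
    rw [mul_right_cancel₀ hvw h1]
    exact hc
  have hw0 : w ≠ 0 := fun h0 => hvw (by rw [h0, dotProduct_zero])
  obtain ⟨E, hE, hfix⟩ := exists_isEigenProjector (τ := τ) (m := m) lam hw0 hw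
  obtain ⟨q, hq, hEq⟩ := hE.exists_isQNumbers h
  have hpos := trace_pos_of_projector hE.1 hE.2.1 hE.2.2.1
  have hME : programMatrix τ m u * E = μ • E := by
    ext x y
    have h1 : E *ᵥ (E.col y) = E.col y := by
      ext z
      exact congrFun (congrFun hE.2.1 z) y
    exact congrFun (hact _ ((hfix _).1 h1)) x
  have htr : ∑ t, u t * q t = μ * E.trace := by
    have h1 : (programMatrix τ m u * E).trace = μ * E.trace := by
      rw [hME, Matrix.trace_smul, smul_eq_mul]
    rw [← h1]
    have h2 : (programMatrix τ m u * E).trace = ∑ x, ∑ y, programMatrix τ m u x y * E x y := by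
      simp only [Matrix.trace, Matrix.diag, Matrix.mul_apply]
      refine Finset.sum_congr rfl fun x _ => Finset.sum_congr rfl fun y _ => ?_
      rw [hE.1.apply x y]
    have h0 : (Fintype.card X : ℝ) ≠ 0 := by simp
    have h3 := sum_programMatrix_mul h u q
    rw [h2, hEq]
    simp only [Matrix.smul_apply, smul_eq_mul, mul_left_comm _ (1 / (Fintype.card X : ℝ)),
      ← Finset.mul_sum] at h3 ⊢
    rw [h3]
    field_simp
  have h4 := hu q hq
  rw [htr] at h4
  exact nonneg_of_mul_nonneg_left h4 hpos

end Scheme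

/-! ### Bounds for the linear program of a two-point homogeneous scheme -/

section Program

variable {X : Type*} [Fintype X] {τ : X → X → ℕ} {m : ℕ}

lemma programMatrix_self (h : IsTwoPointHomogeneous τ m) {u : Fin (m + 1) → ℝ} (hu : u 0 = 1)
    (x : X) : programMatrix τ m u x x = 1 := by
  have : Nonempty X := ⟨x⟩
  have h0 : τ x x = 0 := (h.eq_zero_iff x x).2 rfl
  rw [programMatrix, sum_smul_adjMat_apply h]
  simp [h0, pairCount_zero h, hu]

lemma sum_sum_programMatrix (h : IsTwoPointHomogeneous τ m) (u : Fin (m + 1) → ℝ) :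
    ∑ x, ∑ y, programMatrix τ m u x y = Fintype.card X * ∑ t, u t := by
  have h1 := sum_programMatrix_mul h u fun _ => 1
  simp_rw [sum_smul_adjMat_apply h, mul_one] at h1
  exact h1

lemma programMatrix_mulVec_one (h : IsTwoPointHomogeneous τ m) (u : Fin (m + 1) → ℝ) :
    programMatrix τ m u *ᵥ 1 = (∑ t, u t) • (1 : X → ℝ) := by
  ext x
  have hrow : ∀ z, ∑ y, programMatrix τ m u z y = ∑ y, programMatrix τ m u x y := by
    intro z
    obtain ⟨g, hg, hgz, -⟩ := h.exists_perm x x z z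
      (by rw [(h.eq_zero_iff x x).2 rfl, (h.eq_zero_iff z z).2 rfl])
    rw [← Equiv.sum_comp g, ← hgz]
    exact Finset.sum_congr rfl fun y _ => isInvariantMatrix_sum _ g hg x y
  have h1 := sum_sum_programMatrix h u
  simp_rw [hrow] at h1
  have : Nonempty X := ⟨x⟩
  have h0 : (Fintype.card X : ℝ) ≠ 0 := by simp
  rw [Finset.sum_const, Finset.card_univ, nsmul_eq_mul] at h1
  simpa [Matrix.mulVec, dotProduct] using mul_left_cancel₀ h0 h1

lemma dotProduct_indicator_mulVec (S : Finset X) (A : Matrix X X ℝ) [DecidableEq X] :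
    (fun x => if x ∈ S then (1 : ℝ) else 0) ⬝ᵥ
      (A *ᵥ fun x => if x ∈ S then (1 : ℝ) else 0) = ∑ x ∈ S, ∑ y ∈ S, A x y := by
  simp [Matrix.mulVec, dotProduct]

/-- The restriction of a feasible point to a subset `S` of the scheme: the all-ones vector is an
eigenvector of the positive semidefinite matrix with eigenvalue `∑ u(t)`, and the component of the
indicator of `S` along it accounts for at least its share of the quadratic form. -/
lemma sum_mul_card_sq_le (h : IsTwoPointHomogeneous τ m) {u : Fin (m + 1) → ℝ}
    (hM : (programMatrix τ m u).PosSemidef) (S : Finset X) :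
    (∑ t, u t) * (S.card : ℝ) ^ 2 ≤
      Fintype.card X * ∑ x ∈ S, ∑ y ∈ S, programMatrix τ m u x y := by
  classical
  rcases isEmpty_or_nonempty X with hX | hX
  · simp [Finset.eq_empty_of_isEmpty S]
  set M := programMatrix τ m u
  set f : X → ℝ := fun x => if x ∈ S then (1 : ℝ) else 0
  set l := ∑ t, u t
  set N : ℝ := (Fintype.card X : ℝ) with hN
  have hNpos : 0 < N := by simp [hN, Fintype.card_pos]
  have hM1 : M *ᵥ 1 = l • (1 : X → ℝ) := programMatrix_mulVec_one h u
  have hsymm : M.IsSymm := (isInvariantMatrix_sum _).isSymm h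
  have hf1 : f ⬝ᵥ 1 = S.card := by simp [f, dotProduct]
  have h11 : (1 : X → ℝ) ⬝ᵥ 1 = N := by simp [N]
  have h1f : (1 : X → ℝ) ⬝ᵥ (M *ᵥ f) = l * S.card := by
    rw [Matrix.dotProduct_mulVec, ← Matrix.mulVec_transpose, hsymm, hM1, smul_dotProduct,
      dotProduct_comm, hf1, smul_eq_mul]
  have hq := hM.dotProduct_mulVec_nonneg (N • f - (S.card : ℝ) • 1)
  rw [star_trivial, Matrix.mulVec_sub, Matrix.mulVec_smul, Matrix.mulVec_smul, hM1,
    dotProduct_sub, sub_dotProduct, sub_dotProduct] at hq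
  simp only [dotProduct_smul, smul_dotProduct, smul_eq_mul, h1f, h11, hf1] at hq
  rw [dotProduct_indicator_mulVec] at hq
  have h2 : 0 ≤ N * (N * (∑ x ∈ S, ∑ y ∈ S, M x y) - l * (S.card : ℝ) ^ 2) := by
    refine hq.trans_eq ?_
    ring
  have := nonneg_of_mul_nonneg_right h2 hNpos
  linarith

variable {d : ℕ} {u : Fin (m + 1) → ℝ}

lemma IsDelsarteFeasible.programMatrix_nonneg (h : IsTwoPointHomogeneous τ m)
    (hu : IsDelsarteFeasible τ m d u) (x y : X) : 0 ≤ programMatrix τ m u x y := by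
  obtain ⟨h0, h1, h2, -⟩ := hu
  rw [programMatrix, sum_smul_adjMat_apply h]
  refine div_nonneg (mul_nonneg (by positivity) ?_) (by positivity)
  rcases Nat.eq_zero_or_pos (τ x y) with hz | hz
  · have : (⟨τ x y, Nat.lt_succ_of_le (h.le x y)⟩ : Fin (m + 1)) = 0 := Fin.ext hz
    rw [this, h0]
    exact zero_le_one
  · rcases lt_or_ge (τ x y) d with hd | hd
    · exact (h1 ⟨τ x y, Nat.lt_succ_of_le (h.le x y)⟩ hz hd).ge
    · exact h2 _ hd

lemma IsDelsarteFeasible.programMatrix_eq_zero (h : IsTwoPointHomogeneous τ m)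
    (hu : IsDelsarteFeasible τ m d u) {x y : X} (hxy : x ≠ y) (hd : τ x y < d) :
    programMatrix τ m u x y = 0 := by
  rw [programMatrix, sum_smul_adjMat_apply h,
    hu.2.1 _ (Nat.pos_of_ne_zero fun h0 => hxy ((h.eq_zero_iff x y).1 h0)) hd]
  simp

/-- The averaging argument of Plotkin: if the points of `S` are represented by vectors with inner
products `Δ - τ(y,z)`, where `Δ < d`, then a positive semidefinite matrix coming from a feasible
point has a small sum of entries over `S × S`. -/
lemma IsDelsarteFeasible.sum_programMatrix_le [Nonempty X] (h : IsTwoPointHomogeneous τ m)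
    (hu : IsDelsarteFeasible τ m d u) {ι : Type*} [Fintype ι] (f : ι → X → ℝ) (S : Finset X)
    {Δ : ℝ} (hf : ∀ y ∈ S, ∀ z ∈ S, ∑ i, f i y * f i z = Δ - τ y z) (hΔ : Δ < d) :
    ∑ y ∈ S, ∑ z ∈ S, programMatrix τ m u y z ≤ S.card * (d / (d - Δ)) := by
  classical
  have hM := posSemidef_programMatrix h hu.2.2.2
  have h1 : 0 ≤ ∑ y ∈ S, ∑ z ∈ S, (Δ - τ y z) * programMatrix τ m u y z := by
    have h2 : ∀ i, 0 ≤ ∑ y ∈ S, ∑ z ∈ S, f i y * f i z * programMatrix τ m u y z := by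
      intro i
      have := hM.dotProduct_mulVec_nonneg fun x => if x ∈ S then f i x else 0
      refine this.trans_eq ?_
      simp only [star_trivial, Matrix.mulVec, dotProduct, ite_mul, zero_mul, mul_ite, mul_zero,
        Finset.sum_ite_mem, Finset.univ_inter]
      refine Finset.sum_congr rfl fun y _ => ?_
      rw [Finset.mul_sum]
      exact Finset.sum_congr rfl fun z _ => by ring
    refine (Finset.sum_nonneg (s := Finset.univ) fun i _ => h2 i).trans_eq ?_
    rw [Finset.sum_comm]
    refine Finset.sum_congr rfl fun y hy => ?_
    rw [Finset.sum_comm]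
    refine Finset.sum_congr rfl fun z hz => ?_
    rw [← Finset.sum_mul, hf y hy z hz]
  have h3 : ∀ y z, (Δ - τ y z) * programMatrix τ m u y z ≤ (Δ - d) * programMatrix τ m u y z + if y = z then (d : ℝ) else 0 := by
    intro y z
    by_cases hyz : y = z
    · subst hyz
      rw [programMatrix_self h hu.1, (h.eq_zero_iff y y).2 rfl]
      simp
    · rw [if_neg hyz, add_zero]
      rcases lt_or_ge (τ y z) d with hd | hd
      · rw [hu.programMatrix_eq_zero h hyz hd]; simp
      · have : (d : ℝ) ≤ τ y z := by exact_mod_cast hd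
        exact mul_le_mul_of_nonneg_right (by linarith) (hu.programMatrix_nonneg h y z)
  have h4 := h1.trans (Finset.sum_le_sum fun y (_ : y ∈ S) =>
    Finset.sum_le_sum fun z (_ : z ∈ S) => h3 y z)
  simp only [Finset.sum_add_distrib, ← Finset.mul_sum, Finset.sum_ite_eq, Finset.sum_ite_mem,
    Finset.inter_self, Finset.sum_const, nsmul_eq_mul] at h4
  rw [← mul_div_assoc, le_div_iff₀ (by linarith)]
  linarith

/-- The Elias–Bassalygo argument for the linear program of a two-point homogeneous scheme. -/
lemma IsDelsarteFeasible.sum_le_of_representation [Nonempty X] (h : IsTwoPointHomogeneous τ m)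
    (hu : IsDelsarteFeasible τ m d u) {ι : Type*} [Fintype ι] (f : ι → X → ℝ) (S : Finset X)
    (hS : S.Nonempty)
    {Δ : ℝ} (hf : ∀ y ∈ S, ∀ z ∈ S, ∑ i, f i y * f i z = Δ - τ y z) (hΔ : Δ < d) :
    ∑ t, u t ≤ d / (d - Δ) * (Fintype.card X / S.card) := by
  have h1 := sum_mul_card_sq_le h (posSemidef_programMatrix h hu.2.2.2) S
  have h2 := hu.sum_programMatrix_le h f S hf hΔ
  have hS0 : (0 : ℝ) < S.card := by exact_mod_cast hS.card_pos
  have h3 := h1.trans (mul_le_mul_of_nonneg_left h2 (Nat.cast_nonneg _))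
  have h4 : (∑ t, u t) ≤ (Fintype.card X * (S.card * (d / (d - Δ)))) / (S.card : ℝ) ^ 2 := by
    rwa [le_div_iff₀ (by positivity)]
  refine h4.trans_eq ?_
  field_simp

/-- The bound `|X|` comes from restricting a feasible point to a single element. -/
lemma IsDelsarteFeasible.sum_le_card [Nonempty X] (h : IsTwoPointHomogeneous τ m)
    (hu : IsDelsarteFeasible τ m d u) : ∑ t, u t ≤ Fintype.card X := by
  obtain ⟨x⟩ := ‹Nonempty X›
  have h1 := sum_mul_card_sq_le h (posSemidef_programMatrix h hu.2.2.2) {x}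
  simpa [programMatrix_self h hu.1] using h1

lemma IsDelsarteFeasible.nonneg (hu : IsDelsarteFeasible τ m d u) (t : Fin (m + 1)) :
    0 ≤ u t := by
  rcases Nat.eq_zero_or_pos (t : ℕ) with hz | hz
  · have : t = 0 := Fin.ext hz
    rw [this, hu.1]
    exact zero_le_one
  · rcases lt_or_ge (t : ℕ) d with hd | hd
    · rw [hu.2.1 _ hz hd]
    · exact hu.2.2.1 _ hd

lemma IsEigenProjector.posSemidef {E : Matrix X X ℝ} (hE : IsEigenProjector τ m E) :
    E.PosSemidef := by
  have h1 := Matrix.posSemidef_conjTranspose_mul_self E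
  rwa [Matrix.conjTranspose_eq_transpose_of_trivial, hE.1, hE.2.1] at h1

/-- The inner distribution of a code is a feasible point whose value is the size of the code. -/
lemma card_mem_delsarteValues (h : IsTwoPointHomogeneous τ m) {C : Finset X} (hC : C.Nonempty)
    (hd : ∀ x ∈ C, ∀ y ∈ C, x ≠ y → d ≤ τ x y) : (C.card : ℝ) ∈ delsarteValues τ m d := by
  classical
  have hC0 : (0 : ℝ) < C.card := by exact_mod_cast hC.card_pos
  have : Nonempty X := ⟨hC.choose⟩
  have hX : (0 : ℝ) < Fintype.card X := by exact_mod_cast Fintype.card_pos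
  have key : ∀ q : Fin (m + 1) → ℝ,
      ∑ t : Fin (m + 1), (∑ x ∈ C, ∑ y ∈ C, adjMat τ t x y) / C.card * q t =
        (∑ x ∈ C, ∑ y ∈ C, (∑ t : Fin (m + 1), q t • adjMat τ (t : ℕ)) x y) / C.card := by
    intro q
    simp only [Matrix.sum_apply, Matrix.smul_apply, smul_eq_mul]
    simp_rw [Finset.sum_comm (t := Finset.univ), ← Finset.mul_sum]
    rw [Finset.sum_div]
    exact Finset.sum_congr rfl fun t _ => by ring
  refine ⟨fun t => (∑ x ∈ C, ∑ y ∈ C, adjMat τ t x y) / C.card, ⟨?_, ?_, ?_, ?_⟩, ?_⟩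
  · simp only [adjMat, Matrix.of_apply, Fin.val_zero, h.eq_zero_iff, Finset.sum_ite_eq,
      Finset.sum_ite_mem, Finset.inter_self, Finset.sum_const, nsmul_eq_mul, mul_one]
    exact div_self hC0.ne'
  · intro t ht1 htd
    suffices hs : ∑ x ∈ C, ∑ y ∈ C, adjMat τ t x y = 0 by
      simp only [hs, zero_div]
    refine Finset.sum_eq_zero fun x hx => ?_
    refine Finset.sum_eq_zero fun y hy => ?_
    have : τ x y ≠ t := fun ht => by
      have hxy : x ≠ y := fun hxy => by
        rw [(h.eq_zero_iff x y).2 hxy] at ht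
        omega
      have := hd x hx y hy hxy
      omega
    simp [adjMat, this]
  · intro t _
    refine div_nonneg (Finset.sum_nonneg fun x _ => Finset.sum_nonneg fun y _ => ?_) hC0.le
    simp only [adjMat, Matrix.of_apply]
    split_ifs <;> norm_num
  · rintro q ⟨E, hE, hEq⟩
    rw [key]
    have h1 := hE.posSemidef.dotProduct_mulVec_nonneg fun x => if x ∈ C then (1 : ℝ) else 0
    rw [star_trivial, dotProduct_indicator_mulVec, hEq] at h1
    simp only [Matrix.smul_apply, smul_eq_mul, ← Finset.mul_sum] at h1
    exact div_nonneg (nonneg_of_mul_nonneg_right h1 (by positivity)) hC0.le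
  · have h1 := key fun _ => 1
    simp only [mul_one] at h1
    rw [h1]
    simp_rw [sum_smul_adjMat_apply h]
    simp only [Finset.sum_const, nsmul_eq_mul, mul_one]
    field_simp

/-- The maximum is attained: the feasible points are bounded by `|X|`, so they form a compact
set. -/
lemma isGreatest_delsarteValues [Nonempty X] (h : IsTwoPointHomogeneous τ m) (d : ℕ) :
    IsGreatest (delsarteValues τ m d) (sSup (delsarteValues τ m d)) := by
  have himg : delsarteValues τ m d =
      (fun u : Fin (m + 1) → ℝ => ∑ t, u t) '' {u | IsDelsarteFeasible τ m d u} := by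
    ext s
    exact ⟨fun ⟨u, hu, hs⟩ => ⟨u, hu, hs.symm⟩, fun ⟨u, hu, hs⟩ => ⟨u, hu, hs.symm⟩⟩
  have hclosed : IsClosed {u : Fin (m + 1) → ℝ | IsDelsarteFeasible τ m d u} := by
    simp only [IsDelsarteFeasible, Set.ofPred_and, Set.ofPred_forall]
    refine IsClosed.inter (isClosed_eq (by fun_prop) (by fun_prop)) (IsClosed.inter ?_
      (IsClosed.inter ?_ ?_))
    · exact isClosed_iInter fun t => isClosed_iInter fun _ => isClosed_iInter fun _ =>
        isClosed_eq (by fun_prop) (by fun_prop)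
    · exact isClosed_iInter fun t => isClosed_iInter fun _ =>
        isClosed_le (by fun_prop) (by fun_prop)
    · exact isClosed_iInter fun q => isClosed_iInter fun _ =>
        isClosed_le (by fun_prop) (by fun_prop)
  have hcomp : IsCompact {u : Fin (m + 1) → ℝ | IsDelsarteFeasible τ m d u} := by
    refine (isCompact_univ_pi fun _ : Fin (m + 1) =>
      isCompact_Icc (a := (0 : ℝ)) (b := Fintype.card X)).of_isClosed_subset hclosed ?_
    intro u hu t _
    exact ⟨hu.nonneg t, (Finset.single_le_sum (fun i _ => hu.nonneg i)
      (Finset.mem_univ t)).trans (hu.sum_le_card h)⟩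
  have hne : (delsarteValues τ m d).Nonempty :=
    ⟨_, card_mem_delsarteValues h (Finset.singleton_nonempty (Classical.arbitrary X))
      (by
        intro x hx y hy hxy
        rw [Finset.mem_singleton] at hx hy
        exact absurd (hx.trans hy.symm) hxy)⟩
  refine IsCompact.isGreatest_sSup ?_ hne
  rw [himg]
  exact hcomp.image (by fun_prop)

end Program

/-! ### The geometry of the Johnson scheme -/

section Johnson

variable {n a : ℕ}

/-- The number of common ones of two binary words. -/
def commonOnes (x y : Fin n → ZMod 2) : ℕ :=
  (Finset.univ.filter fun i => x i ≠ 0 ∧ y i ≠ 0).card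

lemma zmod_two_eq_zero_or_one (p : ZMod 2) : p = 0 ∨ p = 1 := by
  revert p
  decide

lemma hammingDist_add_two_mul_commonOnes (x y : Fin n → ZMod 2) :
    hammingDist x y + 2 * commonOnes x y = hammingNorm x + hammingNorm y := by
  simp only [hammingDist, hammingNorm, commonOnes, Finset.card_filter, Finset.mul_sum,
    ← Finset.sum_add_distrib]
  refine Finset.sum_congr rfl fun i _ => ?_
  rcases zmod_two_eq_zero_or_one (x i) with hp | hp <;>
    rcases zmod_two_eq_zero_or_one (y i) with hq | hq <;> simp [hp, hq]

lemma johnsonDist_add_commonOnes (x y : HammingSphere n a) :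
    johnsonDist n a x y + commonOnes x.1 y.1 = a := by
  have h := hammingDist_add_two_mul_commonOnes x.1 y.1
  rw [x.2, y.2] at h
  unfold johnsonDist
  omega

lemma two_mul_johnsonDist (x y : HammingSphere n a) :
    2 * johnsonDist n a x y = hammingDist x.1 y.1 := by
  have h := hammingDist_add_two_mul_commonOnes x.1 y.1
  have h' := johnsonDist_add_commonOnes x y
  rw [x.2, y.2] at h
  omega

/-- The permutation of the words of weight `a` induced by a permutation of the coordinates. -/
def coordPerm (n a : ℕ) (σ : Equiv.Perm (Fin n)) : Equiv.Perm (HammingSphere n a) :=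
  (σ.arrowCongr (Equiv.refl (ZMod 2))).subtypeEquiv fun x => by
    have : hammingNorm (fun i => x (σ.symm i)) = hammingNorm x := by
      simp only [hammingNorm, Finset.card_filter]
      exact Equiv.sum_comp σ.symm fun i => if x i ≠ 0 then 1 else 0
    exact (this ▸ Iff.rfl : hammingNorm x = a ↔ hammingNorm (fun i => x (σ.symm i)) = a)

lemma coordPerm_apply (σ : Equiv.Perm (Fin n)) (x : HammingSphere n a) (i : Fin n) :
    (coordPerm n a σ x).1 i = x.1 (σ.symm i) := rfl

lemma preservesDist_coordPerm (σ : Equiv.Perm (Fin n)) :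
    PreservesDist (johnsonDist n a) (coordPerm n a σ) := by
  intro x y
  have : hammingDist (coordPerm n a σ x).1 (coordPerm n a σ y).1 = hammingDist x.1 y.1 := by
    simp only [hammingDist, Finset.card_filter]
    exact Equiv.sum_comp σ.symm fun i => if x.1 i ≠ y.1 i then 1 else 0
  simp only [johnsonDist, this]

/-- How often each pair of bits occurs in two words is determined by their weights and by the
number of common ones. -/
lemma card_fiber_eq {x y x' y' : Fin n → ZMod 2} (hx : hammingNorm x = hammingNorm x')
    (hy : hammingNorm y = hammingNorm y') (hxy : commonOnes x y = commonOnes x' y')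
    (c : ZMod 2 × ZMod 2) :
    (Finset.univ.filter fun i => (x i, y i) = c).card =
      (Finset.univ.filter fun i => (x' i, y' i) = c).card := by
  -- each count is an affine function of the weights and of the number of common ones
  have key : ∀ x y : Fin n → ZMod 2,
      (Finset.univ.filter fun i => (x i, y i) = ((1 : ZMod 2), (1 : ZMod 2))).card =
        commonOnes x y ∧
      (Finset.univ.filter fun i => (x i, y i) = ((1 : ZMod 2), (0 : ZMod 2))).card +
        commonOnes x y = hammingNorm x ∧
      (Finset.univ.filter fun i => (x i, y i) = ((0 : ZMod 2), (1 : ZMod 2))).card +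
        commonOnes x y = hammingNorm y ∧
      (Finset.univ.filter fun i => (x i, y i) = ((0 : ZMod 2), (0 : ZMod 2))).card +
        hammingNorm x + hammingNorm y = (∑ _i : Fin n, 1) + commonOnes x y := by
    intro x y
    refine ⟨?_, ?_, ?_, ?_⟩
    all_goals
      simp only [hammingNorm, commonOnes, Finset.card_filter, ← Finset.sum_add_distrib]
      refine Finset.sum_congr rfl fun i _ => ?_
      rcases zmod_two_eq_zero_or_one (x i) with hp | hp <;>
        rcases zmod_two_eq_zero_or_one (y i) with hq | hq <;> simp [hp, hq]
  obtain ⟨h1, h2, h3, h4⟩ := key x y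
  obtain ⟨h1', h2', h3', h4'⟩ := key x' y'
  have hc : c = (1, 1) ∨ c = (1, 0) ∨ c = (0, 1) ∨ c = (0, 0) := by
    revert c; decide
  rcases hc with rfl | rfl | rfl | rfl <;> omega

lemma exists_coordPerm {x y x' y' : HammingSphere n a}
    (h : johnsonDist n a x y = johnsonDist n a x' y') :
    ∃ σ : Equiv.Perm (Fin n), coordPerm n a σ x = x' ∧ coordPerm n a σ y = y' := by
  have hc : commonOnes x.1 y.1 = commonOnes x'.1 y'.1 := by
    have := johnsonDist_add_commonOnes x y
    have := johnsonDist_add_commonOnes x' y'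
    omega
  have hfib := card_fiber_eq (x.2.trans x'.2.symm) (y.2.trans y'.2.symm) hc
  have e : ∀ c : ZMod 2 × ZMod 2,
      Nonempty ({i // (x.1 i, y.1 i) = c} ≃ {i // (x'.1 i, y'.1 i) = c}) := by
    intro c
    rw [← Fintype.card_eq, Fintype.card_subtype, Fintype.card_subtype]
    exact hfib c
  let σ : Equiv.Perm (Fin n) := Equiv.ofFiberEquiv fun c => (e c).some
  have hσ : ∀ i, (x'.1 (σ i), y'.1 (σ i)) = (x.1 i, y.1 i) := fun i =>
    Equiv.ofFiberEquiv_map (fun c => (e c).some) i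
  refine ⟨σ, Subtype.ext (funext fun i => ?_), Subtype.ext (funext fun i => ?_)⟩
  · rw [coordPerm_apply]
    simpa using (congrArg Prod.fst (hσ (σ.symm i))).symm
  · rw [coordPerm_apply]
    simpa using (congrArg Prod.snd (hσ (σ.symm i))).symm

/-- The set of positions of the ones of a word. -/
def wordSupport (x : Fin n → ZMod 2) : Finset (Fin n) := Finset.univ.filter fun i => x i ≠ 0

/-- The word with ones at the positions in `T`. -/
def wordOf (T : Finset (Fin n)) : Fin n → ZMod 2 := fun i => if i ∈ T then 1 else 0

lemma wordSupport_wordOf (T : Finset (Fin n)) : wordSupport (wordOf T) = T := by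
  ext i
  simp [wordSupport, wordOf]

lemma wordSupport_injective : Function.Injective (wordSupport (n := n)) := by
  intro x y h
  funext i
  have h1 := congrArg (i ∈ ·) h
  simp only [wordSupport, Finset.mem_filter, Finset.mem_univ, true_and, eq_iff_iff] at h1
  revert h1
  generalize x i = p
  generalize y i = q
  revert p q
  decide

lemma card_wordSupport (x : Fin n → ZMod 2) : (wordSupport x).card = hammingNorm x := rfl

lemma commonOnes_eq (x y : Fin n → ZMod 2) :
    commonOnes x y = (wordSupport x ∩ wordSupport y).card := by
  rw [wordSupport, wordSupport, ← Finset.filter_and]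
  rfl

lemma card_hammingSphere_le (n a : ℕ) : Fintype.card (HammingSphere n a) ≤ n.choose a := by
  have h : ((Finset.univ : Finset (Fin n)).powersetCard a).card = n.choose a := by simp
  rw [← h, ← Finset.card_univ]
  refine Finset.card_le_card_of_injOn (fun x => wordSupport x.1) ?_ ?_
  · intro x _
    simp [card_wordSupport, x.2]
  · intro x _ y _ hxy
    exact Subtype.ext (wordSupport_injective hxy)

lemma nonempty_hammingSphere (h : a ≤ n) : Nonempty (HammingSphere n a) := by
  obtain ⟨T, -, hT⟩ := Finset.exists_subset_card_eq (s := (Finset.univ : Finset (Fin n))) (n := a)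
    (by simpa using h)
  exact ⟨⟨wordOf T, by rw [← card_wordSupport, wordSupport_wordOf, hT]⟩⟩

/-- The sphere of radius `u` around `x` in the Johnson metric. -/
def johnsonSphere (x : HammingSphere n a) (u : ℕ) : Finset (HammingSphere n a) :=
  Finset.univ.filter fun y => johnsonDist n a x y = u

lemma choose_mul_choose_le_card_johnsonSphere (x : HammingSphere n a) {u : ℕ} (hu : u ≤ a) :
    a.choose u * (n - a).choose u ≤ (johnsonSphere x u).card := by
  set A := wordSupport x.1
  have hA : A.card = a := x.2
  have hA' : Aᶜ.card = n - a := by rw [Finset.card_compl, hA, Fintype.card_fin]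
  have hcard : (A.powersetCard u ×ˢ Aᶜ.powersetCard u).card =
      a.choose u * (n - a).choose u := by
    rw [Finset.card_product, Finset.card_powersetCard, Finset.card_powersetCard, hA, hA']
  rw [← hcard]
  refine Finset.card_le_card_of_surjOn
    (fun y => (A \ wordSupport y.1, wordSupport y.1 \ A)) ?_
  rintro ⟨P, Q⟩ hPQ
  simp only [Finset.coe_product, Set.mem_prod, Finset.mem_coe, Finset.mem_powersetCard] at hPQ
  obtain ⟨⟨hP, hPu⟩, hQ, hQu⟩ := hPQ
  have hQA : Disjoint Q A := Finset.disjoint_left.2 fun i hi => Finset.mem_compl.1 (hQ hi)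
  have hdisj : Disjoint (A \ P) Q :=
    (hQA.symm).mono_left Finset.sdiff_subset
  have hAP : (A \ P).card = a - u := by rw [Finset.card_sdiff_of_subset hP, hA, hPu]
  have hT : hammingNorm (wordOf (A \ P ∪ Q)) = a := by
    rw [← card_wordSupport, wordSupport_wordOf, Finset.card_union_of_disjoint hdisj, hAP, hQu]
    omega
  refine ⟨⟨wordOf (A \ P ∪ Q), hT⟩, ?_, ?_⟩
  · have h1 := johnsonDist_add_commonOnes x ⟨wordOf (A \ P ∪ Q), hT⟩
    have h2 : A ∩ (A \ P ∪ Q) = A \ P := by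
      ext i
      have h3 : i ∈ Q → i ∉ A := fun hi => Finset.disjoint_left.1 hQA hi
      simp only [Finset.mem_inter, Finset.mem_union, Finset.mem_sdiff]
      tauto
    rw [commonOnes_eq, wordSupport_wordOf, h2, hAP] at h1
    simp only [johnsonSphere, Finset.coe_filter, Finset.mem_univ, true_and, Set.mem_ofPred_eq]
    omega
  · simp only [wordSupport_wordOf, Prod.mk.injEq]
    constructor
    · ext i
      have h3 : i ∈ Q → i ∉ A := fun hi => Finset.disjoint_left.1 hQA hi
      have h4 : i ∈ P → i ∈ A := fun hi => hP hi
      simp only [Finset.mem_union, Finset.mem_sdiff]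
      tauto
    · ext i
      have h3 : i ∈ Q → i ∉ A := fun hi => Finset.disjoint_left.1 hQA hi
      simp only [Finset.mem_union, Finset.mem_sdiff]
      tauto

lemma johnsonSphere_nonempty (h : a ≤ n / 2) (x : HammingSphere n a) {u : ℕ} (hu : u ≤ a) :
    (johnsonSphere x u).Nonempty := by
  rw [← Finset.card_pos]
  exact (Nat.mul_pos (Nat.choose_pos hu) (Nat.choose_pos (by omega))).trans_le
    (choose_mul_choose_le_card_johnsonSphere x hu)

/-- The coordinate permutations make the Johnson scheme two-point homogeneous. The condition
`a ≤ n / 2` makes every distance up to `a` occur. -/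
lemma isTwoPointHomogeneous_johnsonDist (h : a ≤ n / 2) :
    IsTwoPointHomogeneous (johnsonDist n a) a where
  eq_zero_iff x y := by
    have := two_mul_johnsonDist x y
    rw [Subtype.ext_iff, ← hammingDist_eq_zero]
    omega
  symm x y := by rw [johnsonDist, hammingDist_comm, johnsonDist]
  le x y := by
    have := johnsonDist_add_commonOnes x y
    omega
  exists_pair t ht := by
    obtain ⟨x⟩ := nonempty_hammingSphere (n := n) (a := a) (by omega)
    obtain ⟨y, hy⟩ := johnsonSphere_nonempty h x ht
    exact ⟨x, y, by simpa [johnsonSphere] using hy⟩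
  exists_perm x y x' y' hτ := by
    obtain ⟨σ, hx, hy⟩ := exists_coordPerm hτ
    exact ⟨coordPerm n a σ, preservesDist_coordPerm σ, hx, hy⟩

/-- The `i`-th bit of `x` as a real number. -/
def realBit (x : Fin n → ZMod 2) (i : Fin n) : ℝ := if x i ≠ 0 then 1 else 0

lemma sum_realBit (x : HammingSphere n a) : ∑ i, realBit x.1 i = a := by
  calc ∑ i, realBit x.1 i = (hammingNorm x.1 : ℝ) := by
        simp only [hammingNorm, Finset.card_filter, realBit]
        push_cast
        rfl
    _ = a := by rw [x.2]

lemma sum_realBit_mul (x y : HammingSphere n a) :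
    ∑ i, realBit x.1 i * realBit y.1 i = a - johnsonDist n a x y := by
  have h := johnsonDist_add_commonOnes x y
  have h1 : (commonOnes x.1 y.1 : ℝ) = ∑ i, realBit x.1 i * realBit y.1 i := by
    simp only [commonOnes, Finset.card_filter, realBit]
    push_cast
    refine Finset.sum_congr rfl fun i _ => ?_
    by_cases hx : x.1 i = 0 <;> by_cases hy : y.1 i = 0 <;> simp [hx, hy]
  rw [← h1]
  have h2 : (johnsonDist n a x y : ℝ) + commonOnes x.1 y.1 = a := by exact_mod_cast h
  linarith

/-- The words on the sphere of radius `u` around `x`, translated by the mean of the sphere, have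
inner products `Δ - τ(y,z)`. -/
lemma sum_centered_mul_centered {u : ℕ} (ha : 0 < a) (hn : a < n) (x y z : HammingSphere n a)
    (hy : johnsonDist n a x y = u) (hz : johnsonDist n a x z = u) :
    let p : Fin n → ℝ := fun i =>
      u / ((n : ℝ) - a) + (1 - u / a - u / ((n : ℝ) - a)) * realBit x.1 i
    ∑ i, (realBit y.1 i - p i) * (realBit z.1 i - p i) =
      2 * u - (u : ℝ) ^ 2 * n / (a * (n - a)) - johnsonDist n a y z := by
  intro p
  set b : ℝ := u / ((n : ℝ) - a) with hb
  set c : ℝ := 1 - u / a - u / ((n : ℝ) - a) with hc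
  have hx2 : ∀ i, realBit x.1 i * realBit x.1 i = realBit x.1 i := fun i => by
    unfold realBit; split_ifs <;> simp
  have h1 : ∀ i, (realBit y.1 i - p i) * (realBit z.1 i - p i) =
      realBit y.1 i * realBit z.1 i - b * realBit y.1 i - b * realBit z.1 i
        - c * (realBit x.1 i * realBit y.1 i) - c * (realBit x.1 i * realBit z.1 i)
        + b ^ 2 + (2 * b * c + c ^ 2) * realBit x.1 i := fun i => by
    have := hx2 i
    simp only [p]
    linear_combination c ^ 2 * this
  simp_rw [h1, Finset.sum_add_distrib, Finset.sum_sub_distrib, ← Finset.mul_sum]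
  rw [sum_realBit_mul, sum_realBit_mul, sum_realBit_mul, sum_realBit, sum_realBit, sum_realBit,
    hy, hz]
  have ha' : (a : ℝ) ≠ 0 := by positivity
  have hn' : (n : ℝ) - a ≠ 0 := by
    have : (a : ℝ) < n := by exact_mod_cast hn
    linarith
  simp only [Finset.sum_const, Finset.card_univ, Fintype.card_fin, nsmul_eq_mul]
  rw [hc, hb]
  field_simp
  ring

/-! ### Finite bounds -/

lemma isGreatest_johnsonALP (h : a ≤ n / 2) (d : ℕ) :
    IsGreatest (johnsonValues n d a) (johnsonALP n d a) := by
  have := nonempty_hammingSphere (n := n) (a := a) (by omega)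
  exact isGreatest_delsarteValues (isTwoPointHomogeneous_johnsonDist h) d

lemma card_le_johnsonALP (h : a ≤ n / 2) {d : ℕ} {C : Finset (HammingSphere n a)}
    (hC : C.Nonempty) (hd : ∀ x ∈ C, ∀ y ∈ C, x ≠ y → 2 * d ≤ hammingDist x.1 y.1) :
    (C.card : ℝ) ≤ johnsonALP n d a := by
  refine (isGreatest_johnsonALP h d).2
    (card_mem_delsarteValues (isTwoPointHomogeneous_johnsonDist h) hC ?_)
  intro x hx y hy hxy
  have h1 := hd x hx y hy hxy
  have h2 := two_mul_johnsonDist x y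
  omega

lemma one_le_johnsonALP (h : a ≤ n / 2) (d : ℕ) : 1 ≤ johnsonALP n d a := by
  obtain ⟨x⟩ := nonempty_hammingSphere (n := n) (a := a) (by omega)
  have := card_le_johnsonALP h (d := d) (Finset.singleton_nonempty x) (by
    intro y hy z hz hyz
    rw [Finset.mem_singleton] at hy hz
    exact absurd (hy.trans hz.symm) hyz)
  simpa using this

lemma constWeightA_le_johnsonALP (h : a ≤ n / 2) (d : ℕ) :
    (constWeightA n (2 * d) a : ℝ) ≤ johnsonALP n d a := by
  classical
  have h0 : 0 ≤ johnsonALP n d a := zero_le_one.trans (one_le_johnsonALP h d)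
  rw [← Nat.le_floor_iff h0]
  refine Finset.sup_le fun C hC => ?_
  rw [Nat.le_floor_iff h0]
  rcases C.eq_empty_or_nonempty with rfl | hne
  · simpa using h0
  · exact card_le_johnsonALP h hne (Finset.mem_filter.1 hC).2

lemma johnsonALP_le_choose (h : a ≤ n / 2) (d : ℕ) : johnsonALP n d a ≤ n.choose a := by
  have := nonempty_hammingSphere (n := n) (a := a) (by omega)
  obtain ⟨u, hu, hs⟩ := (isGreatest_johnsonALP h d).1
  rw [hs]
  refine (hu.sum_le_card (isTwoPointHomogeneous_johnsonDist h)).trans ?_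
  exact_mod_cast card_hammingSphere_le n a

/-- The Elias–Bassalygo bound with an arbitrary radius `u` for which the squared radius `Δ` of
the sphere is less than `d`. -/
lemma johnsonALP_le_of_radius (h : a ≤ n / 2) (ha : 0 < a) {d u : ℕ} (hu : u ≤ a)
    (hΔ : 2 * u - (u : ℝ) ^ 2 * n / (a * (n - a)) < d) :
    johnsonALP n d a ≤ d / (d - (2 * u - (u : ℝ) ^ 2 * n / (a * (n - a)))) *
      ((n.choose a : ℝ) / ((a.choose u : ℝ) * ((n - a).choose u : ℝ))) := by
  obtain ⟨x⟩ := nonempty_hammingSphere (n := n) (a := a) (by omega)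
  have hx : Nonempty (HammingSphere n a) := ⟨x⟩
  obtain ⟨v, hv, hs⟩ := (isGreatest_johnsonALP h d).1
  rw [hs]
  have h1 := hv.sum_le_of_representation (isTwoPointHomogeneous_johnsonDist h)
    (fun i y => realBit y.1 i - (u / ((n : ℝ) - a) +
      (1 - u / a - u / ((n : ℝ) - a)) * realBit x.1 i))
    (johnsonSphere x u) (johnsonSphere_nonempty h x hu)
    (fun y hy z hz => sum_centered_mul_centered ha (by omega) x y z
      (by simpa [johnsonSphere] using hy) (by simpa [johnsonSphere] using hz)) hΔ
  refine h1.trans (mul_le_mul_of_nonneg_left ?_ (div_nonneg (Nat.cast_nonneg _) (by linarith)))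
  have h2 : (0 : ℝ) < (a.choose u : ℝ) * ((n - a).choose u : ℝ) := by
    have h3 := Nat.choose_pos hu
    have h4 : 0 < (n - a).choose u := Nat.choose_pos (by omega)
    positivity
  refine div_le_div₀ (Nat.cast_nonneg _) ?_ h2 ?_
  · exact_mod_cast card_hammingSphere_le n a
  · exact_mod_cast choose_mul_choose_le_card_johnsonSphere x hu

/-- The finite Elias–Bassalygo bound. With `ρ = a(n-a)/n` the sphere of radius `u` has
`Δ = ρ (1 - (1 - u/ρ)²)`. -/
lemma johnsonALP_le_ebRadius (h : a ≤ n / 2) {d : ℕ} (hd1 : 1 ≤ d)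
    (hd : (d : ℝ) ≤ (a : ℝ) * (n - a) / n) :
    johnsonALP n d a ≤ ((n : ℝ) - 1) * ((n : ℝ) * d / (a * (n - a))) *
      ((n.choose a : ℝ) /
        ((a.choose (ebRadius n d a) : ℝ) * ((n - a).choose (ebRadius n d a) : ℝ))) := by
  have hd1' : (1 : ℝ) ≤ d := by exact_mod_cast hd1
  have ha : 0 < a := by
    rcases Nat.eq_zero_or_pos a with rfl | h0
    · simp at hd; linarith
    · exact h0
  have ha' : (1 : ℝ) ≤ a := by exact_mod_cast ha
  have han : 2 * (a : ℝ) ≤ n := by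
    have : 2 * a ≤ n := by omega
    exact_mod_cast this
  have hn0 : (0 : ℝ) < n := by linarith
  have hna : (0 : ℝ) < n - a := by linarith
  set ρ : ℝ := (a : ℝ) * (n - a) / n with hρ
  have hρpos : 0 < ρ := by positivity
  have hρa : ρ ≤ a := by
    rw [hρ, div_le_iff₀ hn0]
    exact mul_le_mul_of_nonneg_left (by linarith) (by linarith)
  have hρn : ρ ≤ n - 1 := hρa.trans (by linarith)
  have hdρ : (n : ℝ) * d / (a * (n - a)) = d / ρ := by
    rw [hρ]; field_simp
  have hn1 : (0 : ℝ) < (n : ℝ) - 1 := by linarith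
  set s : ℝ := 1 - d / ρ + 1 / ((n : ℝ) - 1) with hs
  have hs0 : 0 ≤ s := by
    have h1 : d / ρ ≤ 1 := (div_le_one hρpos).2 hd
    have h2 : 0 < 1 / ((n : ℝ) - 1) := by positivity
    linarith
  -- `s ≤ 1` keeps the argument of the floor nonnegative, so that no truncation takes place
  have hs1 : s ≤ 1 := by
    have : 1 / ((n : ℝ) - 1) ≤ d / ρ := div_le_div₀ (by linarith) hd1' hρpos hρn
    linarith
  have hsq : Real.sqrt s ≤ 1 := Real.sqrt_le_one.2 hs1
  have hu : (ebRadius n d a : ℝ) ≤ ρ * (1 - Real.sqrt s) := by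
    rw [ebRadius, hdρ, ← hρ, ← hs]
    exact Nat.floor_le (mul_nonneg hρpos.le (by linarith))
  have hua : ebRadius n d a ≤ a := by
    have h1 : ρ * (1 - Real.sqrt s) ≤ ρ * 1 :=
      mul_le_mul_of_nonneg_left (by linarith [Real.sqrt_nonneg s]) hρpos.le
    have : (ebRadius n d a : ℝ) ≤ a := by linarith
    exact_mod_cast this
  set w := ebRadius n d a
  have hΔ : 2 * (w : ℝ) - (w : ℝ) ^ 2 * n / (a * (n - a)) = ρ * (1 - (1 - w / ρ) ^ 2) := by
    rw [hρ]; field_simp; ring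
  -- the choice of the radius makes `d - Δ` at least `ρ / (n - 1)`
  have hgap : ρ / ((n : ℝ) - 1) ≤ d - (2 * (w : ℝ) - (w : ℝ) ^ 2 * n / (a * (n - a))) := by
    rw [hΔ]
    have h1 : Real.sqrt s ≤ 1 - w / ρ := by
      have : (w : ℝ) / ρ ≤ 1 - Real.sqrt s := by
        rw [div_le_iff₀ hρpos, mul_comm]; exact hu
      linarith
    have h2 : s ≤ (1 - w / ρ) ^ 2 := by
      rw [← Real.sq_sqrt hs0]
      exact pow_le_pow_left₀ (Real.sqrt_nonneg s) h1 2
    have h3 := mul_le_mul_of_nonneg_left h2 hρpos.le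
    have h4 : ρ * s = ρ - d + ρ / ((n : ℝ) - 1) := by
      rw [hs]; field_simp
    linarith
  have hgap0 : 0 < ρ / ((n : ℝ) - 1) := by positivity
  refine (johnsonALP_le_of_radius h ha hua (by linarith)).trans ?_
  refine mul_le_mul_of_nonneg_right ?_ (by positivity)
  rw [hdρ]
  calc (d : ℝ) / (d - (2 * (w : ℝ) - (w : ℝ) ^ 2 * n / (a * (n - a))))
      ≤ d / (ρ / ((n : ℝ) - 1)) := div_le_div_of_nonneg_left (by linarith) hgap0 hgap
    _ = ((n : ℝ) - 1) * (d / ρ) := by field_simp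

end Johnson

/-! ### Asymptotics of binomial coefficients -/

section Asymptotics

open Topology

lemma abs_log_factorial_sub_le (n : ℕ) :
    |Real.log (n.factorial : ℝ) - (n * Real.log n - n)| ≤ 1 + Real.log ((n : ℝ) + 1) := by
  rcases Nat.eq_zero_or_pos n with rfl | hn
  · simp
  have hn' : (1 : ℝ) ≤ n := by exact_mod_cast hn
  have hlogn : 0 ≤ Real.log n := Real.log_nonneg hn'
  have hlog1 : Real.log n ≤ Real.log ((n : ℝ) + 1) :=
    Real.log_le_log (by linarith) (by linarith)
  have hlower : n * Real.log n - n ≤ Real.log (n.factorial : ℝ) := by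
    have h1 := Stirling.le_log_factorial_stirling hn.ne'
    have h2 : 0 ≤ Real.log (2 * Real.pi) :=
      Real.log_nonneg (by linarith [Real.pi_gt_three])
    linarith
  have hupper : Real.log (n.factorial : ℝ) ≤ 1 + Real.log n / 2 + (n * Real.log n - n) := by
    obtain ⟨k, rfl⟩ : ∃ k, n = k + 1 := ⟨n - 1, by omega⟩
    have h1 : Real.log (Stirling.stirlingSeq (k + 1)) ≤ Real.log (Stirling.stirlingSeq 1) :=
      Stirling.log_stirlingSeq'_antitone (Nat.zero_le k)
    rw [Stirling.log_stirlingSeq_formula, Stirling.log_stirlingSeq_formula,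
      Real.log_div (by positivity) (Real.exp_pos 1).ne', Real.log_exp,
      Real.log_mul two_ne_zero (by positivity)] at h1
    simp at h1
    push_cast at h1 ⊢
    linarith
  rw [abs_le]
  constructor <;> linarith

lemma mul_binEntropy_div {n k : ℕ} (hn : 0 < n) (hk : k ≤ n) :
    (n : ℝ) * Real.binEntropy (k / n) =
      n * Real.log n - k * Real.log k - ((n - k : ℕ) : ℝ) * Real.log ((n - k : ℕ) : ℝ) := by
  have hn' : (n : ℝ) ≠ 0 := by positivity
  have key : ∀ j : ℕ, (n : ℝ) * ((j / n) * Real.log ((j : ℝ) / n)⁻¹) =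
      j * Real.log n - j * Real.log j := by
    intro j
    rcases Nat.eq_zero_or_pos j with rfl | hj
    · simp
    · rw [inv_div, Real.log_div hn' (by positivity)]
      field_simp
  have h1 : 1 - (k : ℝ) / n = ((n - k : ℕ) : ℝ) / n := by
    rw [Nat.cast_sub hk]; field_simp
  rw [Real.binEntropy, h1, mul_add, key, key, Nat.cast_sub hk]
  ring

lemma abs_log_choose_sub_le {n k : ℕ} (hk : k ≤ n) :
    |Real.log (n.choose k : ℝ) - n * Real.binEntropy (k / n)| ≤
      3 * (1 + Real.log ((n : ℝ) + 1)) := by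
  rcases Nat.eq_zero_or_pos n with rfl | hn
  · have : k = 0 := by omega
    subst this
    simp
  have h1 : Real.log (n.choose k : ℝ) = Real.log (n.factorial : ℝ) -
      Real.log (k.factorial : ℝ) - Real.log ((n - k).factorial : ℝ) := by
    have hk0 : (k.factorial : ℝ) ≠ 0 := by exact_mod_cast k.factorial_ne_zero
    have hnk0 : ((n - k).factorial : ℝ) ≠ 0 := by exact_mod_cast (n - k).factorial_ne_zero
    have hc : (n.choose k : ℝ) ≠ 0 := by exact_mod_cast (Nat.choose_pos hk).ne'
    rw [← Nat.choose_mul_factorial_mul_factorial hk]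
    push_cast
    rw [Real.log_mul (mul_ne_zero hc hk0) hnk0, Real.log_mul hc hk0]
    ring
  have hmono : ∀ j ≤ n, Real.log ((j : ℝ) + 1) ≤ Real.log ((n : ℝ) + 1) := fun j hj => by
    have : (j : ℝ) ≤ n := by exact_mod_cast hj
    exact Real.log_le_log (by positivity) (by linarith)
  have e1 := abs_le.1 (abs_log_factorial_sub_le n)
  have e2 := abs_le.1 (abs_log_factorial_sub_le k)
  have e3 := abs_le.1 (abs_log_factorial_sub_le (n - k))
  have m2 := hmono k hk
  have m3 := hmono (n - k) (Nat.sub_le n k)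
  rw [h1, mul_binEntropy_div hn hk]
  have hcast : ((n - k : ℕ) : ℝ) = n - k := Nat.cast_sub hk
  rw [abs_le]
  constructor <;> linarith [e1.1, e1.2, e2.1, e2.2, e3.1, e3.2]

lemma tendsto_log_add_one_div :
    Tendsto (fun n : ℕ => 3 * (1 + Real.log ((n : ℝ) + 1)) / n) atTop (𝓝 0) := by
  have h1 : Tendsto (fun n : ℕ => Real.log ((n : ℝ) + 1) / n) atTop (𝓝 0) := by
    have h := (Real.tendsto_pow_log_div_mul_add_atTop 1 (-1) 1 one_ne_zero).comp
      (tendsto_atTop_add_const_right atTop (1 : ℝ) tendsto_natCast_atTop_atTop)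
    refine h.congr fun n => ?_
    simp
  have h2 : Tendsto (fun n : ℕ => (1 : ℝ) / n) atTop (𝓝 0) := tendsto_one_div_atTop_nhds_zero_nat
  have h3 := (h2.add h1).const_mul 3
  simp only [add_zero, mul_zero] at h3
  exact h3.congr fun n => by ring

/-- The exponential growth rate of `binom(A_n, U_n)` when `A_n ~ α n` and `U_n ~ κ n`. -/
lemma tendsto_log_choose_div {A U : ℕ → ℕ} {α κ : ℝ} (hα : α ≠ 0) (hA : ∀ᶠ n in atTop, A n ≤ n)
    (hU : ∀ᶠ n in atTop, U n ≤ A n)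
    (hAα : Tendsto (fun n : ℕ => (A n : ℝ) / n) atTop (𝓝 α))
    (hUκ : Tendsto (fun n : ℕ => (U n : ℝ) / n) atTop (𝓝 κ)) :
    Tendsto (fun n : ℕ => 1 / (n : ℝ) * Real.log ((A n).choose (U n) : ℝ)) atTop
      (𝓝 (α * Real.binEntropy (κ / α))) := by
  have hratio : Tendsto (fun n : ℕ => (U n : ℝ) / A n) atTop (𝓝 (κ / α)) := by
    refine (hUκ.div hAα hα).congr' ?_
    filter_upwards [eventually_gt_atTop 0] with n hn
    have : (n : ℝ) ≠ 0 := by positivity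
    simp only [Pi.div_apply]
    rw [div_div_div_cancel_right₀ this]
  have hmain : Tendsto (fun n : ℕ => (A n : ℝ) / n * Real.binEntropy ((U n : ℝ) / A n)) atTop
      (𝓝 (α * Real.binEntropy (κ / α))) :=
    hAα.mul ((Real.binEntropy_continuous.tendsto _).comp hratio)
  have herr : Tendsto (fun n : ℕ => 1 / (n : ℝ) * Real.log ((A n).choose (U n) : ℝ) -
      (A n : ℝ) / n * Real.binEntropy ((U n : ℝ) / A n)) atTop (𝓝 0) := by
    refine squeeze_zero_norm' ?_ tendsto_log_add_one_div
    filter_upwards [hA, hU, eventually_gt_atTop 0] with n hAn hUn hn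
    have hn' : (0 : ℝ) < n := by exact_mod_cast hn
    have h1 := abs_log_choose_sub_le hUn
    have h2 : Real.log ((A n : ℝ) + 1) ≤ Real.log ((n : ℝ) + 1) := by
      have : (A n : ℝ) ≤ n := by exact_mod_cast hAn
      exact Real.log_le_log (by positivity) (by linarith)
    have h3 : 1 / (n : ℝ) * Real.log ((A n).choose (U n) : ℝ) -
        (A n : ℝ) / n * Real.binEntropy ((U n : ℝ) / A n) =
        (Real.log ((A n).choose (U n) : ℝ) - A n * Real.binEntropy ((U n : ℝ) / A n)) / n := by
      ring
    rw [Real.norm_eq_abs, h3, abs_div, abs_of_pos hn']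
    exact div_le_div_of_nonneg_right (by linarith) hn'.le
  simpa using herr.add hmain

lemma entropyTwo_eq (x : ℝ) : entropyTwo x = Real.binEntropy x / Real.log 2 := by
  rw [entropyTwo, Real.binEntropy, Real.log_inv, Real.log_inv, Real.logb, Real.logb]
  ring

lemma tendsto_floor_mul_div {c : ℝ} (hc : 0 ≤ c) :
    Tendsto (fun n : ℕ => (⌊c * n⌋₊ : ℝ) / n) atTop (𝓝 c) :=
  (tendsto_nat_floor_mul_div_atTop hc).comp tendsto_natCast_atTop_atTop

/-! ### Asymptotic bounds -/

lemma floor_mul_le_half {α : ℝ} (hα : 0 < α) (hα2 : α < 1 / 2) (n : ℕ) :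
    ⌊α * n⌋₊ ≤ n / 2 := by
  have h1 : (⌊α * n⌋₊ : ℝ) ≤ α * n := Nat.floor_le (by positivity)
  have h2 : α * n ≤ 1 / 2 * n := mul_le_mul_of_nonneg_right hα2.le (Nat.cast_nonneg n)
  have h3 : ((2 * ⌊α * n⌋₊ : ℕ) : ℝ) ≤ n := by push_cast; linarith
  have h4 : 2 * ⌊α * n⌋₊ ≤ n := by exact_mod_cast h3
  omega

lemma constWeightA_anti (n a : ℕ) {d d' : ℕ} (h : d ≤ d') :
    constWeightA n d' a ≤ constWeightA n d a := by
  classical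
  refine Finset.sup_mono ?_
  intro C hC
  rw [Finset.mem_filter] at hC ⊢
  exact ⟨hC.1, fun x hx y hy hxy => h.trans (hC.2 x hx y hy hxy)⟩

lemma one_le_constWeightA {n a : ℕ} (h : a ≤ n) (d : ℕ) : 1 ≤ constWeightA n d a := by
  classical
  obtain ⟨x⟩ := nonempty_hammingSphere h
  have : ({x} : Finset (HammingSphere n a)).card ≤ constWeightA n d a := by
    refine Finset.le_sup (f := Finset.card) ?_
    rw [Finset.mem_filter]
    refine ⟨Finset.mem_univ _, fun y hy z hz hyz => ?_⟩
    rw [Finset.mem_singleton] at hy hz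
    exact absurd (hy.trans hz.symm) hyz
  simpa using this

lemma constWeightRate_le_johnsonRateLP {α δ : ℝ} (hα : 0 < α) (hα2 : α < 1 / 2) (hδ : 0 ≤ δ) :
    constWeightRate (2 * δ) α ≤ johnsonRateLP δ α := by
  refine limsup_le_limsup (Eventually.of_forall fun n => ?_)
  have ha := floor_mul_le_half hα hα2 n
  rw [EReal.coe_le_coe_iff]
  refine mul_le_mul_of_nonneg_left ?_ (by positivity)
  have hfloor : 2 * ⌊δ * n⌋₊ ≤ ⌊2 * δ * n⌋₊ := by
    refine Nat.le_floor ?_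
    have : (⌊δ * n⌋₊ : ℝ) ≤ δ * n := Nat.floor_le (by positivity)
    push_cast
    linarith
  have h1 : (constWeightA n ⌊2 * δ * n⌋₊ ⌊α * n⌋₊ : ℝ) ≤
      constWeightA n (2 * ⌊δ * n⌋₊) ⌊α * n⌋₊ := by
    exact_mod_cast constWeightA_anti n _ hfloor
  have h2 : 1 ≤ constWeightA n ⌊2 * δ * n⌋₊ ⌊α * n⌋₊ := one_le_constWeightA (by omega) _
  exact Real.logb_le_logb_of_le one_lt_two (by exact_mod_cast h2)
    (h1.trans (constWeightA_le_johnsonALP ha _))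

lemma johnsonRateLP_le_of_tendsto {δ α L : ℝ} {f : ℕ → ℝ} (hf : Tendsto f atTop (𝓝 L))
    (hle : ∀ᶠ n : ℕ in atTop,
      1 / (n : ℝ) * Real.log (johnsonALP n ⌊δ * n⌋₊ ⌊α * n⌋₊) ≤ f n) :
    johnsonRateLP δ α ≤ ((L / Real.log 2 : ℝ) : EReal) := by
  have h1 : Tendsto (fun n => ((f n / Real.log 2 : ℝ) : EReal)) atTop
      (𝓝 ((L / Real.log 2 : ℝ) : EReal)) :=
    (continuous_coe_real_ereal.tendsto _).comp (hf.div_const _)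
  rw [← h1.limsup_eq]
  refine limsup_le_limsup ?_
  filter_upwards [hle] with n hn
  rw [EReal.coe_le_coe_iff, Real.logb, ← mul_div_assoc]
  exact div_le_div_of_nonneg_right hn (Real.log_nonneg one_le_two)

lemma tendsto_log_choose_floor {α : ℝ} (hα : 0 < α) (hα2 : α < 1 / 2) :
    Tendsto (fun n : ℕ => 1 / (n : ℝ) * Real.log (n.choose ⌊α * n⌋₊ : ℝ)) atTop
      (𝓝 (Real.binEntropy α)) := by
  have h := tendsto_log_choose_div (A := fun n => n) (U := fun n => ⌊α * n⌋₊) (α := 1) (κ := α)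
    one_ne_zero (Eventually.of_forall fun n => le_rfl)
    (Eventually.of_forall fun n => (floor_mul_le_half hα hα2 n).trans (Nat.div_le_self n 2))
    (tendsto_const_nhds.congr' (by
      filter_upwards [eventually_gt_atTop 0] with n hn
      exact (div_self (by positivity)).symm))
    (tendsto_floor_mul_div hα.le)
  simpa using h

/-- The asymptotic bound for spheres of relative radius `κ`: the condition on `κ` says that the
relative squared radius of the sphere is less than `δ`. -/
lemma johnsonRateLP_le_of_radius {α δ κ : ℝ} (hα : 0 < α) (hα2 : α < 1 / 2) (hκ : 0 < κ)
    (hκα : κ < α) (hδ : 0 < δ) (hΔ : 2 * κ - κ ^ 2 / (α * (1 - α)) < δ) :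
    johnsonRateLP δ α ≤ (((Real.binEntropy α - (α * Real.binEntropy (κ / α) +
      (1 - α) * Real.binEntropy (κ / (1 - α)))) / Real.log 2 : ℝ) : EReal) := by
  set a : ℕ → ℕ := fun n => ⌊α * n⌋₊ with ha
  set d : ℕ → ℕ := fun n => ⌊δ * n⌋₊ with hd
  set u : ℕ → ℕ := fun n => ⌊κ * n⌋₊ with hu
  set D : ℕ → ℝ := fun n => 2 * u n - (u n : ℝ) ^ 2 * n / (a n * (n - a n)) with hD
  have han : ∀ n, a n ≤ n / 2 := floor_mul_le_half hα hα2
  have ta : Tendsto (fun n => (a n : ℝ) / n) atTop (𝓝 α) := tendsto_floor_mul_div hα.le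
  have td : Tendsto (fun n => (d n : ℝ) / n) atTop (𝓝 δ) := tendsto_floor_mul_div hδ.le
  have tu : Tendsto (fun n => (u n : ℝ) / n) atTop (𝓝 κ) := tendsto_floor_mul_div hκ.le
  have tb : Tendsto (fun n => ((n - a n : ℕ) : ℝ) / n) atTop (𝓝 (1 - α)) := by
    refine (ta.const_sub 1).congr' ?_
    filter_upwards [eventually_gt_atTop 0] with n hn
    have hn' : (n : ℝ) ≠ 0 := by positivity
    rw [Nat.cast_sub ((han n).trans (Nat.div_le_self n 2))]
    field_simp
  have hpos : α * (1 - α) ≠ 0 := (mul_pos hα (by linarith)).ne'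
  have tD : Tendsto (fun n => D n / n) atTop (𝓝 (2 * κ - κ ^ 2 / (α * (1 - α)))) := by
    refine ((tu.const_mul 2).sub ((tu.pow 2).div (ta.mul (ta.const_sub 1)) hpos)).congr' ?_
    filter_upwards [eventually_gt_atTop 0] with n hn
    have hn' : (n : ℝ) ≠ 0 := by positivity
    simp only [hD, Pi.div_apply]
    rw [sub_div, ← mul_div_assoc]
    congr 1
    have h1 : (a n : ℝ) / n * (1 - a n / n) = (a n * (n - a n)) / n ^ 2 := by field_simp
    rw [h1]
    by_cases h2 : (a n : ℝ) * (n - a n) = 0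
    · simp [h2]
    · field_simp
  have hdD : ∀ᶠ n : ℕ in atTop, D n < d n := by
    filter_upwards [tD.eventually_lt td hΔ, eventually_gt_atTop 0] with n h1 hn
    have hn' : (0 : ℝ) < n := by exact_mod_cast hn
    exact (div_lt_div_iff_of_pos_right hn').1 h1
  have hua : ∀ᶠ n : ℕ in atTop, u n ≤ a n := by
    refine Eventually.of_forall fun n => Nat.floor_mono ?_
    exact mul_le_mul_of_nonneg_right hκα.le (Nat.cast_nonneg n)
  have hub : ∀ᶠ n : ℕ in atTop, u n ≤ n - a n := by
    filter_upwards [hua] with n hn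
    have := han n
    omega
  have hapos : ∀ᶠ n : ℕ in atTop, 0 < a n := by
    filter_upwards [ta.eventually (lt_mem_nhds hα)] with n hn
    by_contra h0
    have : a n = 0 := by omega
    simp [this] at hn
  have hdpos : ∀ᶠ n : ℕ in atTop, 0 < d n := by
    filter_upwards [td.eventually (lt_mem_nhds hδ)] with n hn
    by_contra h0
    have : d n = 0 := by omega
    simp [this] at hn
  -- the Plotkin factor `d / (d - Δ)` converges, so it does not contribute to the rate
  have tfac : Tendsto (fun n : ℕ => 1 / (n : ℝ) * Real.log (d n / (d n - D n))) atTop (𝓝 0) := by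
    have hgap : δ - (2 * κ - κ ^ 2 / (α * (1 - α))) ≠ 0 := by linarith
    have h1 : Tendsto (fun n : ℕ => (d n : ℝ) / (d n - D n)) atTop
        (𝓝 (δ / (δ - (2 * κ - κ ^ 2 / (α * (1 - α)))))) := by
      refine (td.div (td.sub tD) hgap).congr' ?_
      filter_upwards [eventually_gt_atTop 0] with n hn
      have hn' : (n : ℝ) ≠ 0 := by positivity
      simp only [Pi.div_apply]
      rw [← sub_div, div_div_div_cancel_right₀ hn']
    have h2 := (tendsto_one_div_atTop_nhds_zero_nat (𝕜 := ℝ)).mul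
      (h1.log (div_ne_zero hδ.ne' hgap))
    simpa using h2
  have t1 := tendsto_log_choose_floor hα hα2
  have t2 := tendsto_log_choose_div hα.ne'
    (Eventually.of_forall fun n => (han n).trans (Nat.div_le_self n 2)) hua ta tu
  have t3 := tendsto_log_choose_div (by linarith : 1 - α ≠ 0)
    (Eventually.of_forall fun n => Nat.sub_le n (a n)) hub tb tu
  have tsum := tfac.add (t1.sub (t2.add t3))
  rw [zero_add] at tsum
  refine johnsonRateLP_le_of_tendsto tsum ?_
  filter_upwards [hdD, hua, hub, hapos, hdpos] with n h1 h2 h3 h4 h5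
  have hbound := johnsonALP_le_of_radius (han n) h4 h2 h1
  have hlog := Real.log_le_log (zero_lt_one.trans_le (one_le_johnsonALP (han n) (d n))) hbound
  have c1 : (n.choose (a n) : ℝ) ≠ 0 := by
    exact_mod_cast (Nat.choose_pos ((han n).trans (Nat.div_le_self n 2))).ne'
  have c2 : ((a n).choose (u n) : ℝ) ≠ 0 := by exact_mod_cast (Nat.choose_pos h2).ne'
  have c3 : ((n - a n).choose (u n) : ℝ) ≠ 0 := by exact_mod_cast (Nat.choose_pos h3).ne'
  have c4 : (d n : ℝ) / (d n - D n) ≠ 0 :=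
    div_ne_zero (by positivity) (by linarith)
  rw [Real.log_mul c4 (div_ne_zero c1 (mul_ne_zero c2 c3)),
    Real.log_div c1 (mul_ne_zero c2 c3), Real.log_mul c2 c3] at hlog
  refine (mul_le_mul_of_nonneg_left hlog (by positivity : (0 : ℝ) ≤ 1 / n)).trans_eq ?_
  ring

lemma johnsonRateLP_le {α δ : ℝ} (hα : 0 < α) (hα2 : α < 1 / 2) (hδ : 0 ≤ δ)
    (hδα : δ ≤ α * (1 - α)) :
    johnsonRateLP δ α ≤ ((entropyTwo α - (α * entropyTwo (ebK δ α / α) +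
      (1 - α) * entropyTwo (ebK δ α / (1 - α))) : ℝ) : EReal) := by
  have hρ : 0 < α * (1 - α) := mul_pos hα (by linarith)
  set G : ℝ → ℝ := fun κ => (Real.binEntropy α - (α * Real.binEntropy (κ / α) +
    (1 - α) * Real.binEntropy (κ / (1 - α)))) / Real.log 2 with hG
  have hgoal : entropyTwo α - (α * entropyTwo (ebK δ α / α) +
      (1 - α) * entropyTwo (ebK δ α / (1 - α))) = G (ebK δ α) := by
    simp only [entropyTwo_eq, hG]
    ring
  rw [hgoal]
  rcases hδ.eq_or_lt with rfl | hδ0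
  · have hK : ebK 0 α = 0 := by simp [ebK]
    have hG0 : G 0 = Real.binEntropy α / Real.log 2 := by simp [hG]
    rw [hK, hG0]
    refine johnsonRateLP_le_of_tendsto (tendsto_log_choose_floor hα hα2)
      (Eventually.of_forall fun n => ?_)
    have ha := floor_mul_le_half hα hα2 n
    exact mul_le_mul_of_nonneg_left (Real.log_le_log
      (zero_lt_one.trans_le (one_le_johnsonALP ha _)) (johnsonALP_le_choose ha _)) (by positivity)
  set s := Real.sqrt (1 - δ / (α * (1 - α))) with hs
  have hs_nonneg : 0 ≤ s := Real.sqrt_nonneg _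
  have hquot : 0 ≤ 1 - δ / (α * (1 - α)) := by
    have : δ / (α * (1 - α)) ≤ 1 := (div_le_one hρ).2 hδα
    linarith
  have hs_sq : s ^ 2 = 1 - δ / (α * (1 - α)) := Real.sq_sqrt hquot
  have hs1 : s < 1 := by
    have : 0 < δ / (α * (1 - α)) := by positivity
    nlinarith
  have hK : ebK δ α = α * (1 - α) * (1 - s) := rfl
  have hKpos : 0 < ebK δ α := by
    rw [hK]
    exact mul_pos hρ (by linarith)
  have hKα : ebK δ α < α := by
    rw [hK]
    nlinarith
  have hcont : Continuous G := by
    have := Real.binEntropy_continuous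
    fun_prop
  have hlim : Tendsto (fun κ => ((G κ : ℝ) : EReal)) (𝓝[<] (ebK δ α))
      (𝓝 ((G (ebK δ α) : ℝ) : EReal)) :=
    ((continuous_coe_real_ereal.comp hcont).tendsto _).mono_left nhdsWithin_le_nhds
  refine ge_of_tendsto hlim ?_
  filter_upwards [Ioo_mem_nhdsLT hKpos] with κ hκ
  refine johnsonRateLP_le_of_radius hα hα2 hκ.1 (hκ.2.trans hKα) hδ0 ?_
  have h1 : s < 1 - κ / (α * (1 - α)) := by
    have : κ / (α * (1 - α)) < 1 - s := by
      rw [div_lt_iff₀ hρ, mul_comm]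
      exact hκ.2
    linarith
  have h2 : s ^ 2 < (1 - κ / (α * (1 - α))) ^ 2 := pow_lt_pow_left₀ h1 hs_nonneg two_ne_zero
  rw [hs_sq] at h2
  have h3 := mul_lt_mul_of_pos_left h2 hρ
  have h4 : α * (1 - α) * (1 - δ / (α * (1 - α))) = α * (1 - α) - δ := by
    rw [mul_sub, mul_one, mul_div_cancel₀ _ hρ.ne']
  have h5 : α * (1 - α) * (1 - κ / (α * (1 - α))) ^ 2 =
      α * (1 - α) - (2 * κ - κ ^ 2 / (α * (1 - α))) := by
    generalize α * (1 - α) = ρ at hρ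
    field_simp
    ring
  linarith

end Asymptotics
end

theorem mainTheorem6 :
    (∀ n a d : ℕ, a ≤ n / 2 → (d : ℝ) ≤ (a : ℝ) * (n - a) / n →
      IsGreatest (johnsonValues n d a) (johnsonALP n d a) ∧
      (constWeightA n (2 * d) a : ℝ) ≤ johnsonALP n d a ∧
      (1 ≤ d →
        johnsonALP n d a ≤
          ((n : ℝ) - 1) * ((n : ℝ) * d / (a * (n - a))) *
            ((n.choose a : ℝ) /
              ((a.choose (ebRadius n d a) : ℝ) * ((n - a).choose (ebRadius n d a) : ℝ))))) ∧
    (∀ α δ : ℝ, 0 < α → α < 1 / 2 → 0 ≤ δ → δ ≤ α * (1 - α) →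
      constWeightRate (2 * δ) α ≤ johnsonRateLP δ α ∧
      johnsonRateLP δ α ≤
        ((entropyTwo α - (α * entropyTwo (ebK δ α / α) +
          (1 - α) * entropyTwo (ebK δ α / (1 - α))) : ℝ) : EReal)) :=
  ⟨fun _ _ d ha hd => ⟨isGreatest_johnsonALP ha d, constWeightA_le_johnsonALP ha d,
      fun hd1 => johnsonALP_le_ebRadius ha hd1 hd⟩,
    fun _ _ hα hα2 hδ hδα => ⟨constWeightRate_le_johnsonRateLP hα hα2 hδ,
      johnsonRateLP_le hα hα2 hδ hδα⟩⟩
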